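/- Let $d\ge 3$ and let $V:\mathbb R^d\to[0,\infty)$ be locally integrable, not almost everywhere zero, and in the reverse Hölder class $RH_s(\mathbb R^d)$ for some $s\in[d/2,\infty]$; that is, there is a constant $C>0$ with $$\Big(\frac1{|B|}\int_B V^s\,dy\Big)^{1/s}\le C\,\frac1{|B|}\int_B V\,dy\quad\text{for every ball }B\subset\mathbb R^d$$ (with the essential supremum of $V$ over $B$ on the left if $s=\infty$). Let $$\rho(x)=\sup\Big\{r>0:\ \frac1{r^{d-2}}\int_{B(x,r)}V(y)\,dy\le 1\Big\},\qquad x\in\mathbb R^d,$$ be the critical radius function of $V$. Let $Q(x_0,r)$ denote the cube with centre $x_0$, side length $r>0$ and sides parallel to the axes. For $\theta>0$, a locally integrable $f:\mathbb R^d\to\mathbb R$ belongs to $\mathrm{BLO}_{\rho,\theta}(\mathbb R^d)$ if there is a constant $c>0$ such that for every cube $Q=Q(x_0,r)$ $$\frac1{|Q|}\int_{Q}\Big[f(x)-\operatorname*{ess\,inf}_{Q}f\Big]dx\le c\,\Big(1+\frac r{\rho(x_0)}\Big)^{\theta}$$ (in particular $\operatorname{ess\,inf}_Q f>-\infty$),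 and $\|f\|_{\mathrm{BLO}_{\rho,\theta}}$ denotes the infimum of all such $c$. There exist constants $C_0\ge 1$ and $N_0>0$ such that $$\frac1{C_0}\Big(1+\frac{|x-y|}{\rho(x)}\Big)^{-N_0}\le\frac{\rho(y)}{\rho(x)}\le C_0\Big(1+\frac{|x-y|}{\rho(x)}\Big)^{\frac{N_0}{N_0+1}}\quad\text{for all }x,y\in\mathbb R^d. \tag{1}$$ For any $C_0\ge1$, $N_0>0$ satisfying (1) and any $\theta>0$ there are constants $C,\gamma>0$ such that for every $f\in\mathrm{BLO}_{\rho,\theta}(\mathbb R^d)$ and every cube $Q=Q(x_0,r)$ in $\mathbb R^d$, $$\int_Q\exp\Big[\Big(1+\frac r{\rho(x_0)}\Big)^{-(N_0+1)\theta}\,\frac{\gamma}{\|f\|_{\mathrm{BLO}_{\rho,\theta}}}\Big(f(x)-\operatorname*{ess\,inf}_{Q}f\Big)\Big]dx\le C\,|Q|.$$ (If $\|f\|_{\mathrm{BLO}_{\rho,\theta}}=0$, then $f$ is a.e. constant and the exponent is read as $0$.) -/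

import Mathlib

open MeasureTheory
open scoped ENNReal

noncomputable section

namespace SchrodingerBLO

/-- The (closed) cube with sides parallel to the axes, centre `x₀` and side length `r`. -/
def cube {d : ℕ} (x₀ : EuclideanSpace ℝ (Fin d)) (r : ℝ) : Set (EuclideanSpace ℝ (Fin d)) :=
  {x | ∀ i, |x i - x₀ i| ≤ r / 2}

/-- The reverse Hölder class `RH_s`, `1 < s ≤ ∞`: the normalized `L^s` norm of `V` over every ball
is at most a constant times the mean value of `V` over that ball. For `s < ∞` the `eLpNorm` below
is `(|B|⁻¹ ∫_B |V|^s)^{1/s}`, for `s = ∞` it is the essential supremum of `|V|` over `B`;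
it is infinite where these are infinite. -/
def ReverseHolder {d : ℕ} (s : ℝ≥0∞) (V : EuclideanSpace ℝ (Fin d) → ℝ) : Prop :=
  ∃ C : ℝ, 0 < C ∧ ∀ (x : EuclideanSpace ℝ (Fin d)) (r : ℝ), 0 < r →
    eLpNorm V s ((volume (Metric.ball x r))⁻¹ • volume.restrict (Metric.ball x r)) ≤
      ENNReal.ofReal (C * ⨍ y in Metric.ball x r, V y)

/-- The critical radius function
`ρ(x) = sup {r > 0 : r^{-(d-2)} ∫_{B(x,r)} V ≤ 1}` (used for `d ≥ 3` only). -/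
def criticalRadius {d : ℕ} (V : EuclideanSpace ℝ (Fin d) → ℝ)
    (x : EuclideanSpace ℝ (Fin d)) : ℝ :=
  sSup {r : ℝ | 0 < r ∧ 1 / r ^ (d - 2) * ∫ y in Metric.ball x r, V y ≤ 1}

/-- `C₀ ≥ 1` and `N₀ > 0` are constants for which the two-sided comparison
`C₀⁻¹ (1 + |x-y|/ρ(x))^{-N₀} ≤ ρ(y)/ρ(x) ≤ C₀ (1 + |x-y|/ρ(x))^{N₀/(N₀+1)}`
holds for all points `x`, `y`. -/
def ComparisonConstants {d : ℕ} (ρ : EuclideanSpace ℝ (Fin d) → ℝ) (C₀ N₀ : ℝ) : Prop :=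
  1 ≤ C₀ ∧ 0 < N₀ ∧ ∀ x y : EuclideanSpace ℝ (Fin d),
    1 / C₀ * (1 + ‖x - y‖ / ρ x) ^ (-N₀) ≤ ρ y / ρ x ∧
    ρ y / ρ x ≤ C₀ * (1 + ‖x - y‖ / ρ x) ^ (N₀ / (N₀ + 1))

/-- The essential infimum of `f` over `Q`. -/
def essInfOn {d : ℕ} (f : EuclideanSpace ℝ (Fin d) → ℝ) (Q : Set (EuclideanSpace ℝ (Fin d))) : ℝ :=
  essInf f (volume.restrict Q)

/-- `c` is a constant in the defining inequality of `BLO_{ρ,θ}`. On every cube `f` has to be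
essentially bounded below (otherwise its essential infimum is `-∞` and the mean value below is
`+∞`), so that `essInfOn` is the true essential infimum. -/
def IsBLOBound {d : ℕ} (ρ : EuclideanSpace ℝ (Fin d) → ℝ) (θ : ℝ)
    (f : EuclideanSpace ℝ (Fin d) → ℝ) (c : ℝ) : Prop :=
  0 < c ∧ ∀ (x₀ : EuclideanSpace ℝ (Fin d)) (r : ℝ), 0 < r →
    (∃ m : ℝ, ∀ᵐ x ∂(volume.restrict (cube x₀ r)), m ≤ f x) ∧
    (⨍ x in cube x₀ r, (f x - essInfOn f (cube x₀ r))) ≤ c * (1 + r / ρ x₀) ^ θ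

/-- The space `BLO_{ρ,θ}`. -/
def MemBLO {d : ℕ} (ρ : EuclideanSpace ℝ (Fin d) → ℝ) (θ : ℝ)
    (f : EuclideanSpace ℝ (Fin d) → ℝ) : Prop :=
  LocallyIntegrable f volume ∧ ∃ c : ℝ, IsBLOBound ρ θ f c

/-- The `BLO_{ρ,θ}`-constant of `f`: the infimum of the admissible constants. -/
def bloNorm {d : ℕ} (ρ : EuclideanSpace ℝ (Fin d) → ℝ) (θ : ℝ)
    (f : EuclideanSpace ℝ (Fin d) → ℝ) : ℝ :=
  sInf {c : ℝ | IsBLOBound ρ θ f c}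

end SchrodingerBLO

end

noncomputable section

namespace SchrodingerBLO

open Metric Filter Topology

/-! The exponential estimate is a John–Nirenberg inequality, proved without stopping times by a
Bellman function argument. Suppose that on every subcube of a cube the mean `X` exceeds the
essential infimum `m` by at most `K`. The function `exp (l m) (1 + 2 l (X - m))` is affine in `X`
and, in the relevant range, decreasing in `m`. Halving a cube averages the `X` of its children to
the parental one and only raises `m`, so the mean of this function over the children is at most its
value at the parent (`exp_mul_one_add_le`, `exists_dyadic_minorant`). This bounds `∫ exp (l m_n)`,
where `m_n` is the infimum over the dyadic cell of generation `n`. Lebesgue differentiation, `X ≤ m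
+ K` and Fatou's lemma pass from `m_n` to the function itself
(`lintegral_exp_le_of_boundedLowerOscillation`).

For `BLO_{ρ,θ}` the oscillation bound on a subcube carries the weight of that subcube. The lower
half of the comparison (1) bounds this weight by the `(N₀ + 1)`-th power of the weight of the large
cube (`one_add_div_le_of_mem_cube`), whence the exponent `(N₀ + 1) θ`.

The comparison (1) itself rests on two facts: `∫_B V` grows at most polynomially, and the scaled
mass `r ^ (2 - d) ∫_{B(x,r)} V` decays like a power as `r → 0`. At the endpoint `p = d / 2` Hölder's
inequality alone gives no decay. However, the `p`-th power of the scaled mass is comparable to `∫_B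
V ^ p`, which is doubling and hence reverse doubling; this gives the decay without self-improvement
of the reverse Hölder exponent (`exists_growth_of_reverseHolder`). -/

/-! ### Dyadic subdivision of sup-norm balls -/

/-- The centres of the `2 ^ d` dyadic children of the sup-norm ball of centre `c` and radius `R`. -/
def childCenter {d : ℕ} (c : Fin d → ℝ) (R : ℝ) (s : Fin d → Bool) : Fin d → ℝ :=
  fun i => c i + if s i then R / 2 else -(R / 2)

/-- The orthant around `c` which contains `x`. -/
def orthant {d : ℕ} (c x : Fin d → ℝ) : Fin d → Bool := fun i => decide (c i ≤ x i)

theorem mem_closedBall_pi {d : ℕ} {c x : Fin d → ℝ} {R : ℝ} (hR : 0 ≤ R) :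
    x ∈ closedBall c R ↔ ∀ i, |x i - c i| ≤ R := by
  rw [mem_closedBall, dist_pi_le_iff hR]
  simp [Real.dist_eq]

theorem measurable_orthant {d : ℕ} (c : Fin d → ℝ) : Measurable (orthant c) := by
  refine measurable_pi_iff.2 fun i => ?_
  refine measurable_to_bool ?_
  have : (fun x : Fin d → ℝ => orthant c x i) ⁻¹' {true} = {x | c i ≤ x i} := by
    ext x; simp [orthant]
  rw [this]
  exact measurableSet_le measurable_const (measurable_pi_apply i)

theorem childBall_subset {d : ℕ} (c : Fin d → ℝ) {R : ℝ} (hR : 0 < R) (s : Fin d → Bool) :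
    closedBall (childCenter c R s) (R / 2) ⊆ closedBall c R := by
  intro x hx
  rw [mem_closedBall_pi (by positivity)] at hx
  rw [mem_closedBall_pi hR.le]
  intro i
  have := hx i
  simp only [childCenter] at this
  rw [abs_le] at this ⊢
  split_ifs at this <;> constructor <;> linarith

theorem inter_orthant_subset_childBall {d : ℕ} (c : Fin d → ℝ) {R : ℝ} (hR : 0 < R)
    (s : Fin d → Bool) :
    closedBall c R ∩ orthant c ⁻¹' {s} ⊆ closedBall (childCenter c R s) (R / 2) := by
  rintro x ⟨hx, rfl⟩
  rw [mem_closedBall_pi hR.le] at hx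
  rw [mem_closedBall_pi (by positivity)]
  intro i
  have := hx i
  simp only [childCenter, orthant, decide_eq_true_eq]
  rw [abs_le] at this ⊢
  split_ifs with h <;> constructor <;> linarith

/-- The orthants give a genuine partition, while closed children overlap on faces; the faces lie in
the null hyperplanes `x i = c i`. -/
theorem inter_orthant_ae_eq_childBall {d : ℕ} (c : Fin d → ℝ) {R : ℝ} (hR : 0 < R)
    (s : Fin d → Bool) :
    (closedBall c R ∩ orthant c ⁻¹' {s} : Set (Fin d → ℝ)) =ᵐ[volume]
      closedBall (childCenter c R s) (R / 2) := by
  have hnull : ∀ᵐ x : Fin d → ℝ, ∀ i, x i ≠ c i := by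
    refine ae_all_iff.2 fun i => ?_
    exact Measure.ae_eval_ne (α := fun _ : Fin d => ℝ) (μ := fun _ => volume) i (c i)
  filter_upwards [hnull] with x hx
  refine propext ⟨fun h => inter_orthant_subset_childBall c hR s h, fun h => ⟨?_, ?_⟩⟩
  · exact childBall_subset c hR s h
  · have h' := (mem_closedBall_pi (by positivity)).1 h
    refine funext fun i => ?_
    have h1 := h' i
    simp only [childCenter] at h1
    rw [abs_le] at h1
    cases hs : s i with
    | true => simp [hs] at h1; simp [orthant]; linarith
    | false =>
      simp [hs] at h1; simp [orthant]
      exact lt_of_le_of_ne (by linarith) (hx i)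

theorem closedBall_eq_iUnion_inter_orthant {d : ℕ} (c : Fin d → ℝ) (R : ℝ) :
    closedBall c R = ⋃ s : Fin d → Bool, closedBall c R ∩ orthant c ⁻¹' {s} := by
  ext x; simp

theorem measurableSet_inter_orthant {d : ℕ} (c : Fin d → ℝ) (R : ℝ) (s : Fin d → Bool) :
    MeasurableSet (closedBall c R ∩ orthant c ⁻¹' {s}) :=
  isClosed_closedBall.measurableSet.inter (measurable_orthant c (measurableSet_singleton s))

theorem pairwise_disjoint_inter_orthant {d : ℕ} (c : Fin d → ℝ) (R : ℝ) :
    Pairwise (Function.onFun Disjoint fun s : Fin d → Bool =>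
      closedBall c R ∩ orthant c ⁻¹' {s}) := by
  intro s t hst
  refine Set.disjoint_left.2 ?_
  rintro x ⟨_, rfl⟩ ⟨_, h⟩
  exact hst h

theorem volume_childBall {d : ℕ} (c : Fin d → ℝ) {R : ℝ} (hR : 0 < R) (s : Fin d → Bool) :
    volume (closedBall (childCenter c R s) (R / 2)) =
      ENNReal.ofReal ((2 ^ d)⁻¹) * volume (closedBall c R) := by
  rw [Real.volume_pi_closedBall _ (by positivity), Real.volume_pi_closedBall _ hR.le,
    ← ENNReal.ofReal_mul (by positivity)]
  congr 1
  rw [Fintype.card_fin, mul_pow, div_pow, mul_pow]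
  field_simp

theorem volumeReal_closedBall_pos {d : ℕ} (c : Fin d → ℝ) {R : ℝ} (hR : 0 < R) :
    0 < volume.real (closedBall c R) :=
  ENNReal.toReal_pos (measure_closedBall_pos _ _ hR).ne' measure_closedBall_lt_top.ne

theorem sum_average_childBall {d : ℕ} {F : (Fin d → ℝ) → ℝ} (hF : LocallyIntegrable F)
    (c : Fin d → ℝ) {R : ℝ} (hR : 0 < R) :
    ∑ s : Fin d → Bool, (⨍ x in closedBall (childCenter c R s) (R / 2), F x) =
      2 ^ d * ⨍ x in closedBall c R, F x := by
  have hint : ∫ x in closedBall c R, F x =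
      ∑ s : Fin d → Bool, ∫ x in closedBall (childCenter c R s) (R / 2), F x := by
    conv_lhs => rw [closedBall_eq_iUnion_inter_orthant c R]
    rw [integral_iUnion_fintype (measurableSet_inter_orthant c R)
      (pairwise_disjoint_inter_orthant c R)]
    · exact Finset.sum_congr rfl fun s _ =>
        setIntegral_congr_set (inter_orthant_ae_eq_childBall c hR s)
    · exact fun s => (hF.integrableOn_isCompact (isCompact_closedBall c R)).mono_set
        Set.inter_subset_left
  have hpos := volumeReal_closedBall_pos c hR
  simp_rw [setAverage_eq, smul_eq_mul, hint, measureReal_def, volume_childBall c hR,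
    ENNReal.toReal_mul]
  rw [ENNReal.toReal_ofReal (by positivity), ← Finset.mul_sum, mul_inv, inv_inv, mul_assoc]

/-- The function `exp (l m) (1 + 2 l (X - m))` decreases in `m` as long as `2 l (X - m) ≤ 1`. -/
theorem exp_mul_one_add_le {l m m' X : ℝ} (hl : 0 ≤ l) (hm : m ≤ m') (hX : m' ≤ X)
    (hL : 2 * (l * (X - m)) ≤ 1) :
    Real.exp (l * m') * (1 + 2 * l * (X - m')) ≤ Real.exp (l * m) * (1 + 2 * l * (X - m)) := by
  set p := l * (m' - m) with hp
  set q := l * (X - m') with hq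
  have hp0 : 0 ≤ p := mul_nonneg hl (by linarith)
  have hq0 : 0 ≤ q := mul_nonneg hl (by linarith)
  have hpq : 2 * p + 2 * q ≤ 1 := by rw [hp, hq]; linarith
  have e1 : Real.exp (l * m') = Real.exp (l * m) * Real.exp p := by
    rw [← Real.exp_add]; congr 1; rw [hp]; ring
  have e2 : 1 + 2 * l * (X - m) = 1 + 2 * p + 2 * q := by rw [hp, hq]; ring
  have e3 : 1 + 2 * l * (X - m') = 1 + 2 * q := by rw [hq]; ring
  rw [e1, e2, e3, mul_assoc]
  refine mul_le_mul_of_nonneg_left ?_ (Real.exp_pos _).le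
  have h1 : Real.exp p * (1 - p) ≤ 1 := by
    calc Real.exp p * (1 - p) ≤ Real.exp p * Real.exp (-p) :=
          mul_le_mul_of_nonneg_left (Real.one_sub_le_exp_neg p) (Real.exp_pos _).le
      _ = 1 := by rw [← Real.exp_add]; simp
  -- The difference of the two sides is `p (1 - 2 p - 2 q)`.
  have h2 : 1 + 2 * q ≤ (1 - p) * (1 + 2 * p + 2 * q) := by nlinarith
  calc Real.exp p * (1 + 2 * q) ≤ Real.exp p * ((1 - p) * (1 + 2 * p + 2 * q)) :=
        mul_le_mul_of_nonneg_left h2 (Real.exp_pos _).le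
    _ = (Real.exp p * (1 - p)) * (1 + 2 * p + 2 * q) := by ring
    _ ≤ 1 * (1 + 2 * p + 2 * q) := mul_le_mul_of_nonneg_right h1 (by positivity)
    _ = _ := one_mul _

/-! ### The John–Nirenberg inequality by a Bellman function -/

theorem le_setAverage_of_ae_le {d : ℕ} {F : (Fin d → ℝ) → ℝ} (hF : LocallyIntegrable F)
    {c : Fin d → ℝ} {R a : ℝ} (hR : 0 < R)
    (h : ∀ᵐ x ∂(volume.restrict (closedBall c R)), a ≤ F x) :
    a ≤ ⨍ x in closedBall c R, F x := by
  have hpos := volumeReal_closedBall_pos c hR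
  have h1 : ∫ _x in closedBall c R, a ≤ ∫ x in closedBall c R, F x :=
    integral_mono_ae (integrable_const_iff.2 (Or.inr
      (by rw [isFiniteMeasure_restrict]; exact measure_closedBall_lt_top.ne)))
      (hF.integrableOn_isCompact (isCompact_closedBall c R)) h
  rw [setIntegral_const, smul_eq_mul] at h1
  rw [setAverage_eq, smul_eq_mul, inv_mul_eq_div, le_div_iff₀ hpos]
  linarith

/-- Here `m c R` plays the role of the infimum of `F` over a cell, and `h` is its value on the cell
of generation `n` containing the point. The induction applies the bound for `n` to each child,
replaces the child's `m` by the parent's through `exp_mul_one_add_le`, and sums; affinity in the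
mean makes the sum exact. -/
theorem exists_dyadic_minorant {d : ℕ} {F : (Fin d → ℝ) → ℝ} {m : (Fin d → ℝ) → ℝ → ℝ}
    {Q : Set (Fin d → ℝ)} {K l : ℝ} (hl : 0 ≤ l) (hlK : 2 * (l * (2 ^ d * K)) ≤ 1)
    (hF : LocallyIntegrable F)
    (hle : ∀ c R, 0 < R → closedBall c R ⊆ Q →
      ∀ᵐ x ∂(volume.restrict (closedBall c R)), m c R ≤ F x)
    (hmono : ∀ c R c' R', 0 < R → 0 < R' → closedBall c' R' ⊆ closedBall c R → closedBall c R ⊆ Q →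
      m c R ≤ m c' R')
    (havg : ∀ c R, 0 < R → closedBall c R ⊆ Q → ⨍ x in closedBall c R, F x ≤ m c R + K)
    (n : ℕ) : ∀ (c : Fin d → ℝ) (R : ℝ), 0 < R → closedBall c R ⊆ Q →
      ∃ h : (Fin d → ℝ) → ℝ, Measurable h ∧
        (∀ x ∈ closedBall c R, ∃ c', x ∈ closedBall c' (R / 2 ^ n) ∧
          closedBall c' (R / 2 ^ n) ⊆ closedBall c R ∧ h x = m c' (R / 2 ^ n)) ∧
        ∫⁻ x in closedBall c R, ENNReal.ofReal (Real.exp (l * h x)) ≤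
          ENNReal.ofReal (Real.exp (l * m c R) *
            (1 + 2 * l * ((⨍ x in closedBall c R, F x) - m c R))) * volume (closedBall c R) := by
  induction n with
  | zero =>
    intro c R hR hQ
    refine ⟨fun _ => m c R, measurable_const, fun x hx => ⟨c, by simpa using hx, by simp, by simp⟩,
      ?_⟩
    rw [setLIntegral_const]
    gcongr
    have h0 := le_setAverage_of_ae_le hF hR (hle c R hR hQ)
    refine le_mul_of_one_le_right (Real.exp_pos _).le ?_
    have : 0 ≤ 2 * l * ((⨍ x in closedBall c R, F x) - m c R) :=
      mul_nonneg (by positivity) (by linarith)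
    linarith
  | succ n ih =>
    intro c R hR hQ
    have hR2 : 0 < R / 2 := by positivity
    have hsub := fun s => (childBall_subset c hR s).trans hQ
    choose h hmeas hcell hint using
      fun s : Fin d → Bool => ih (childCenter c R s) (R / 2) hR2 (hsub s)
    have hhalf : R / 2 / 2 ^ n = R / 2 ^ (n + 1) := by rw [pow_succ]; field_simp
    refine ⟨fun x => h (orthant c x) x, ?_, ?_, ?_⟩
    · exact (measurable_from_prod_countable_right (f := fun p : (Fin d → Bool) × (Fin d → ℝ) =>
        h p.1 p.2) hmeas).comp ((measurable_orthant c).prodMk measurable_id)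
    · intro x hx
      obtain ⟨c', h1, h2, h3⟩ := hcell (orthant c x) x
        (inter_orthant_subset_childBall c hR _ ⟨hx, rfl⟩)
      rw [hhalf] at h1 h2 h3
      exact ⟨c', h1, h2.trans (childBall_subset c hR _), h3⟩
    · set X : (Fin d → Bool) → ℝ := fun s => ⨍ x in closedBall (childCenter c R s) (R / 2), F x
        with hX
      have hsum := sum_average_childBall hF c hR
      set X₀ := ⨍ x in closedBall c R, F x with hX₀
      have hmX : ∀ s, m (childCenter c R s) (R / 2) ≤ X s := fun s =>
        le_setAverage_of_ae_le hF hR2 (hle _ _ hR2 (hsub s))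
      have hmm : ∀ s, m c R ≤ m (childCenter c R s) (R / 2) := fun s =>
        hmono _ _ _ _ hR hR2 (childBall_subset c hR s) hQ
      -- All `2 ^ d` differences `X t - m c R` are nonnegative, so one of them is at most their sum;
      -- this is the source of the factor `2 ^ d` in the smallness condition on `l`.
      have hXm : ∀ s, X s - m c R ≤ 2 ^ d * K := by
        intro s
        have h1 : X s - m c R ≤ ∑ t, (X t - m c R) :=
          Finset.single_le_sum (f := fun t => X t - m c R)
            (fun t _ => by linarith [hmX t, hmm t]) (Finset.mem_univ s)
        have h2 : ∑ t, (X t - m c R) = 2 ^ d * (X₀ - m c R) := by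
          rw [Finset.sum_sub_distrib, hsum]; simp; ring
        have h3 := havg c R hR hQ
        have h4 : (2 : ℝ) ^ d * (X₀ - m c R) ≤ 2 ^ d * K :=
          mul_le_mul_of_nonneg_left (by linarith) (by positivity)
        linarith
      have hB : ∀ s, ∫⁻ x in closedBall (childCenter c R s) (R / 2),
          ENNReal.ofReal (Real.exp (l * h s x)) ≤
          ENNReal.ofReal (Real.exp (l * m c R) * (1 + 2 * l * (X s - m c R)) * (2 ^ d)⁻¹) *
            volume (closedBall c R) := by
        intro s
        refine (hint s).trans ?_
        have hexp := exp_mul_one_add_le hl (hmm s) (hmX s)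
          ((mul_le_mul_of_nonneg_left (mul_le_mul_of_nonneg_left (hXm s) hl) two_pos.le).trans hlK)
        rw [volume_childBall c hR, ← mul_assoc, ← ENNReal.ofReal_mul' (by positivity)]
        gcongr
      have hnn : ∀ s, 0 ≤ Real.exp (l * m c R) * (1 + 2 * l * (X s - m c R)) * (2 ^ d)⁻¹ := by
        intro s
        have : 0 ≤ l * (X s - m c R) := mul_nonneg hl (by linarith [hmX s, hmm s])
        have : 0 ≤ 1 + 2 * l * (X s - m c R) := by linarith
        positivity
      calc ∫⁻ x in closedBall c R, ENNReal.ofReal (Real.exp (l * h (orthant c x) x))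
          = ∑ s, ∫⁻ x in closedBall c R ∩ orthant c ⁻¹' {s},
              ENNReal.ofReal (Real.exp (l * h (orthant c x) x)) := by
            conv_lhs => rw [closedBall_eq_iUnion_inter_orthant c R]
            rw [lintegral_iUnion (measurableSet_inter_orthant c R)
              (pairwise_disjoint_inter_orthant c R), tsum_fintype]
        _ ≤ ∑ s, ENNReal.ofReal (Real.exp (l * m c R) * (1 + 2 * l * (X s - m c R)) *
              (2 ^ d)⁻¹) * volume (closedBall c R) := by
            refine Finset.sum_le_sum fun s _ => le_trans ?_ (hB s)
            rw [setLIntegral_congr_fun (g := fun x => ENNReal.ofReal (Real.exp (l * h s x)))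
              (measurableSet_inter_orthant c R s)]
            · exact lintegral_mono_set (inter_orthant_subset_childBall c hR s)
            · rintro x ⟨_, rfl⟩; rfl
        _ = _ := by
            rw [← Finset.sum_mul, ← ENNReal.ofReal_sum_of_nonneg fun s _ => hnn s]
            congr 2
            rw [← Finset.sum_mul, ← Finset.mul_sum, Finset.sum_add_distrib, ← Finset.mul_sum,
              Finset.sum_sub_distrib, hsum]
            simp
            field_simp

/-- The John–Nirenberg inequality for functions with bounded lower oscillation. -/
theorem lintegral_exp_le_of_boundedLowerOscillation {d : ℕ} {F : (Fin d → ℝ) → ℝ}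
    {m : (Fin d → ℝ) → ℝ → ℝ} {c : Fin d → ℝ} {R K l : ℝ} (hR : 0 < R) (hl : 0 ≤ l)
    (hK : 0 ≤ K)
    (hlK : 2 * (l * (2 ^ d * K)) ≤ 1) (hF : LocallyIntegrable F)
    (hle : ∀ c' R', 0 < R' → closedBall c' R' ⊆ closedBall c R →
      ∀ᵐ x ∂(volume.restrict (closedBall c' R')), m c' R' ≤ F x)
    (hmono : ∀ c₁ R₁ c₂ R₂, 0 < R₁ → 0 < R₂ → closedBall c₂ R₂ ⊆ closedBall c₁ R₁ →
      closedBall c₁ R₁ ⊆ closedBall c R → m c₁ R₁ ≤ m c₂ R₂)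
    (havg : ∀ c' R', 0 < R' → closedBall c' R' ⊆ closedBall c R →
      ⨍ x in closedBall c' R', F x ≤ m c' R' + K) :
    ∫⁻ x in closedBall c R, ENNReal.ofReal (Real.exp (l * (F x - m c R))) ≤
      ENNReal.ofReal 6 * volume (closedBall c R) := by
  choose h hmeas hcell hint using fun n =>
    exists_dyadic_minorant hl hlK hF hle hmono havg n c R hR subset_rfl
  have hlK1 : 2 * (l * K) ≤ 1 := by
    refine le_trans ?_ hlK
    have : (1 : ℝ) ≤ 2 ^ d := one_le_pow₀ one_le_two
    have : K ≤ 2 ^ d * K := le_mul_of_one_le_left hK this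
    gcongr
  set m₀ := m c R with hm₀
  have hpt : ∀ᵐ x ∂(volume.restrict (closedBall c R)),
      ENNReal.ofReal (Real.exp (l * (F x - m₀))) ≤
      liminf (fun n => ENNReal.ofReal (Real.exp (l * K - l * m₀)) *
        ENNReal.ofReal (Real.exp (l * h n x))) atTop := by
    -- The cells contain `x` but need not be centred at it, so differentiation is needed along
    -- eccentric balls; the parameter `1` allows every ball that contains the point.
    have hdiff := ae_restrict_of_ae (s := closedBall c R)
      (IsUnifLocDoublingMeasure.ae_tendsto_average volume hF 1)
    filter_upwards [hdiff, ae_restrict_mem isClosed_closedBall.measurableSet] with x hx hxQ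
    choose c' hxc hc' hh using fun n => hcell n x hxQ
    have hδ : Tendsto (fun n : ℕ => R / 2 ^ n) atTop (𝓝[>] 0) := by
      refine tendsto_nhdsWithin_iff.2 ⟨?_, Eventually.of_forall fun n => ?_⟩
      · have := (tendsto_pow_atTop_nhds_zero_of_lt_one (r := (1 / 2 : ℝ)) (by norm_num)
          (by norm_num)).const_mul R
        simpa [div_eq_mul_inv] using this
      · exact div_pos hR (by positivity)
    have hlim := hx c' (fun n => R / 2 ^ n) hδ (Eventually.of_forall fun n => by
      simpa using hxc n)
    have hlim2 : Tendsto (fun n => ENNReal.ofReal (Real.exp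
        (l * ((⨍ y in closedBall (c' n) (R / 2 ^ n), F y) - m₀)))) atTop
        (𝓝 (ENNReal.ofReal (Real.exp (l * (F x - m₀))))) :=
      ENNReal.tendsto_ofReal ((Real.continuous_exp.tendsto _).comp
        ((hlim.sub_const m₀).const_mul l))
    rw [← hlim2.liminf_eq]
    refine liminf_le_liminf (Eventually.of_forall fun n => ?_)
    rw [← ENNReal.ofReal_mul (Real.exp_pos _).le, ← Real.exp_add]
    refine ENNReal.ofReal_le_ofReal (Real.exp_le_exp.2 ?_)
    have h1 := havg (c' n) (R / 2 ^ n) (by positivity) (hc' n)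
    rw [← hh n] at h1
    nlinarith [mul_le_mul_of_nonneg_left h1 hl]
  -- Since `l K ≤ 1 / 2`, the exponential is at most `e ≤ 3` and the other factor at most `2`.
  have h6 : Real.exp (l * K - l * m₀) * (Real.exp (l * m₀) *
      (1 + 2 * l * ((⨍ x in closedBall c R, F x) - m₀))) ≤ 6 := by
    rw [← mul_assoc, ← Real.exp_add]
    have h1 := havg c R hR subset_rfl
    have h2 := le_setAverage_of_ae_le hF hR (hle c R hR subset_rfl)
    have h3 : l * ((⨍ x in closedBall c R, F x) - m₀) ≤ l * K :=
      mul_le_mul_of_nonneg_left (by linarith) hl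
    have h4 : Real.exp (l * K - l * m₀ + l * m₀) ≤ 3 :=
      (Real.exp_le_exp.2 (by linarith : _ ≤ (1 : ℝ))).trans (by linarith [Real.exp_one_lt_d9])
    have h5 : 0 ≤ l * ((⨍ x in closedBall c R, F x) - m₀) := mul_nonneg hl (by linarith)
    calc _ ≤ 3 * (1 + 2 * l * ((⨍ x in closedBall c R, F x) - m₀)) :=
          mul_le_mul_of_nonneg_right h4 (by linarith)
      _ ≤ 6 := by linarith
  calc ∫⁻ x in closedBall c R, ENNReal.ofReal (Real.exp (l * (F x - m₀)))
      ≤ ∫⁻ x in closedBall c R, liminf (fun n => ENNReal.ofReal (Real.exp (l * K - l * m₀)) *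
        ENNReal.ofReal (Real.exp (l * h n x))) atTop := lintegral_mono_ae hpt
    _ ≤ liminf (fun n => ∫⁻ x in closedBall c R, ENNReal.ofReal (Real.exp (l * K - l * m₀)) *
        ENNReal.ofReal (Real.exp (l * h n x))) atTop := by
        refine lintegral_liminf_le fun n => ?_
        have := hmeas n
        fun_prop
    _ ≤ liminf (fun _ : ℕ => ENNReal.ofReal 6 * volume (closedBall c R)) atTop := by
        refine liminf_le_liminf (Eventually.of_forall fun n => ?_)
        rw [lintegral_const_mul' _ _ ENNReal.ofReal_ne_top]
        refine (mul_le_mul_right (hint n) _).trans ?_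
        rw [← mul_assoc, ← ENNReal.ofReal_mul (Real.exp_pos _).le]
        gcongr
    _ = _ := liminf_const _

/-! ### Cubes in Euclidean space -/

theorem cube_eq_preimage {d : ℕ} (x₀ : EuclideanSpace ℝ (Fin d)) {r : ℝ} (hr : 0 ≤ r) :
    cube x₀ r = WithLp.ofLp ⁻¹' closedBall (WithLp.ofLp x₀) (r / 2) := by
  ext x
  rw [Set.mem_preimage, mem_closedBall_pi (by positivity)]
  rfl

theorem volume_cube {d : ℕ} (x₀ : EuclideanSpace ℝ (Fin d)) {r : ℝ} (hr : 0 ≤ r) :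
    volume (cube x₀ r) = volume (closedBall (WithLp.ofLp x₀) (r / 2)) := by
  rw [cube_eq_preimage x₀ hr]
  exact (PiLp.volume_preserving_ofLp (Fin d)).measure_preimage
    isClosed_closedBall.measurableSet.nullMeasurableSet

theorem isCompact_cube {d : ℕ} (x₀ : EuclideanSpace ℝ (Fin d)) {r : ℝ} (hr : 0 ≤ r) :
    IsCompact (cube x₀ r) := by
  have : cube x₀ r = WithLp.toLp 2 '' closedBall (WithLp.ofLp x₀) (r / 2) := by
    rw [cube_eq_preimage x₀ hr]
    ext x
    exact ⟨fun h => ⟨WithLp.ofLp x, h, rfl⟩, by rintro ⟨y, hy, rfl⟩; exact hy⟩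
  rw [this]
  exact (isCompact_closedBall _ _).image (PiLp.continuous_toLp 2 _)

theorem volumeReal_cube_pos {d : ℕ} (x₀ : EuclideanSpace ℝ (Fin d)) {r : ℝ} (hr : 0 < r) :
    0 < volume.real (cube x₀ r) := by
  rw [measureReal_def, volume_cube x₀ hr.le]
  exact volumeReal_closedBall_pos _ (by positivity)

theorem norm_sub_le_of_mem_cube {d : ℕ} {x₀ x : EuclideanSpace ℝ (Fin d)} {r : ℝ} (hr : 0 ≤ r)
    (hx : x ∈ cube x₀ r) : ‖x₀ - x‖ ≤ (d + 1) * r := by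
  have h1 : ‖x₀ - x‖ ^ 2 ≤ ((d + 1) * r) ^ 2 := by
    rw [EuclideanSpace.norm_sq_eq]
    calc ∑ i, ‖(x₀ - x) i‖ ^ 2 ≤ ∑ _i : Fin d, r ^ 2 := by
          refine Finset.sum_le_sum fun i _ => ?_
          have h : |x i - x₀ i| ≤ r / 2 := hx i
          rw [PiLp.sub_apply, Real.norm_eq_abs, abs_sub_comm]
          gcongr
          linarith
      _ = d * r ^ 2 := by simp
      _ ≤ ((d + 1) * r) ^ 2 := by
          rw [mul_pow]
          gcongr
          have : (0 : ℝ) ≤ d := Nat.cast_nonneg d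
          nlinarith
  exact le_of_sq_le_sq h1 (by positivity)

/-- A real essential infimum is a supremum of lower bounds and is meaningful only if these are
bounded above; the mean of `f` over the cube bounds them. -/
theorem isCoboundedUnder_restrict_cube {d : ℕ} {f : EuclideanSpace ℝ (Fin d) → ℝ}
    (hf : LocallyIntegrable f) (x₀ : EuclideanSpace ℝ (Fin d)) {r : ℝ} (hr : 0 < r) :
    (ae (volume.restrict (cube x₀ r))).IsCoboundedUnder (· ≥ ·) f := by
  refine ⟨⨍ x in cube x₀ r, f x, fun a ha => ?_⟩
  have hpos := volumeReal_cube_pos x₀ hr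
  have h1 : ∫ _x in cube x₀ r, a ≤ ∫ x in cube x₀ r, f x :=
    integral_mono_ae (integrable_const_iff.2 (Or.inr
      (by rw [isFiniteMeasure_restrict]; exact (isCompact_cube x₀ hr.le).measure_lt_top.ne)))
      (hf.integrableOn_isCompact (isCompact_cube x₀ hr.le)) (eventually_map.1 ha)
  rw [setIntegral_const, smul_eq_mul] at h1
  change a ≤ _
  rw [setAverage_eq, smul_eq_mul, inv_mul_eq_div, le_div_iff₀ hpos]
  linarith

theorem ae_essInfOn_le {d : ℕ} {f : EuclideanSpace ℝ (Fin d) → ℝ}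
    {Q : Set (EuclideanSpace ℝ (Fin d))} (h : ∃ m : ℝ, ∀ᵐ x ∂(volume.restrict Q), m ≤ f x) :
    ∀ᵐ x ∂(volume.restrict Q), essInfOn f Q ≤ f x := by
  obtain ⟨m, hm⟩ := h
  exact ae_essInf_le ⟨m, eventually_map.2 hm⟩

theorem essInfOn_cube_mono {d : ℕ} {f : EuclideanSpace ℝ (Fin d) → ℝ} (hf : LocallyIntegrable f)
    {Q : Set (EuclideanSpace ℝ (Fin d))} (h : ∃ m : ℝ, ∀ᵐ x ∂(volume.restrict Q), m ≤ f x)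
    {x₀ : EuclideanSpace ℝ (Fin d)} {r : ℝ} (hr : 0 < r) (hQ : cube x₀ r ⊆ Q) :
    essInfOn f Q ≤ essInfOn f (cube x₀ r) :=
  le_essInf_of_ae_le _ (ae_restrict_of_ae_restrict_of_subset hQ (ae_essInfOn_le h))
    (isCoboundedUnder_restrict_cube hf x₀ hr)

/-- The measure preserving identification with `Fin d → ℝ` turns cubes of side `2 R` into sup-norm
balls of radius `R`, where the preceding inequality applies. -/
theorem integral_exp_cube_le {d : ℕ} {f : EuclideanSpace ℝ (Fin d) → ℝ} (hf : LocallyIntegrable f)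
    {x₀ : EuclideanSpace ℝ (Fin d)} {r K l : ℝ} (hr : 0 < r) (hl : 0 ≤ l) (hK : 0 ≤ K)
    (hlK : 2 * (l * (2 ^ d * K)) ≤ 1)
    (hbdd : ∀ y s, 0 < s → ∃ m : ℝ, ∀ᵐ x ∂(volume.restrict (cube y s)), m ≤ f x)
    (havg : ∀ y s, 0 < s → cube y s ⊆ cube x₀ r →
      ⨍ x in cube y s, (f x - essInfOn f (cube y s)) ≤ K) :
    IntegrableOn (fun x => Real.exp (l * (f x - essInfOn f (cube x₀ r)))) (cube x₀ r) ∧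
      ∫ x in cube x₀ r, Real.exp (l * (f x - essInfOn f (cube x₀ r))) ≤
        6 * volume.real (cube x₀ r) := by
  have hmp : MeasurePreserving (WithLp.toLp 2 : (Fin d → ℝ) → EuclideanSpace ℝ (Fin d)) :=
    PiLp.volume_preserving_toLp (Fin d)
  have hemb : MeasurableEmbedding (WithLp.toLp 2 : (Fin d → ℝ) → EuclideanSpace ℝ (Fin d)) :=
    (MeasurableEquiv.toLp 2 (Fin d → ℝ)).measurableEmbedding
  have hcube : ∀ (c : Fin d → ℝ) (R : ℝ), 0 ≤ R →
      WithLp.toLp 2 ⁻¹' cube (WithLp.toLp 2 c) (2 * R) = closedBall c R := by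
    intro c R hR
    ext x
    rw [cube_eq_preimage _ (by positivity)]
    simp
  have hsubset : ∀ (c : Fin d → ℝ) (R : ℝ) (c' : Fin d → ℝ) (R' : ℝ), 0 < R' →
      closedBall c' R' ⊆ closedBall c R →
      cube (WithLp.toLp 2 c') (2 * R') ⊆ cube (WithLp.toLp 2 c) (2 * R) := by
    intro c R c' R' hR' h x hx
    have hR : 0 ≤ R := nonempty_closedBall.1 ((nonempty_closedBall.2 hR'.le).mono h)
    rw [cube_eq_preimage _ (by positivity)] at hx ⊢
    simp only [Set.mem_preimage] at hx ⊢
    have e : ∀ t : ℝ, 2 * t / 2 = t := fun t => by ring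
    rw [e] at hx ⊢
    exact h hx
  have hF : LocallyIntegrable (fun x : Fin d → ℝ => f (WithLp.toLp 2 x)) := by
    rw [locallyIntegrable_iff]
    intro k hk
    have := hf.integrableOn_isCompact (hk.image (PiLp.continuous_toLp 2 (fun _ : Fin d => ℝ)))
    rw [← hmp.integrableOn_comp_preimage hemb] at this
    rwa [Set.preimage_image_eq _ hemb.injective] at this
  have hx₀ : (WithLp.toLp 2 (WithLp.ofLp x₀) : EuclideanSpace ℝ (Fin d)) = x₀ := rfl
  have hr2 : 2 * (r / 2) = r := by ring
  have key := lintegral_exp_le_of_boundedLowerOscillation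
    (F := fun x => f (WithLp.toLp 2 x))
    (m := fun c R => essInfOn f (cube (WithLp.toLp 2 c) (2 * R)))
    (c := WithLp.ofLp x₀) (R := r / 2) (by positivity) hl hK hlK hF ?_ ?_ ?_
  · simp only [hx₀, hr2] at key
    have hlint : ∫⁻ x in cube x₀ r,
        ENNReal.ofReal (Real.exp (l * (f x - essInfOn f (cube x₀ r)))) ≤
        ENNReal.ofReal 6 * volume (cube x₀ r) := by
      rw [volume_cube x₀ hr.le]
      refine le_trans (le_of_eq ?_) key
      have := hcube (WithLp.ofLp x₀) (r / 2) (by positivity)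
      rw [hr2, hx₀] at this
      rw [← this, hmp.setLIntegral_comp_preimage_emb hemb
        (fun x => ENNReal.ofReal (Real.exp (l * (f x - essInfOn f (cube x₀ r)))))]
    have hfin : volume (cube x₀ r) ≠ ∞ := (isCompact_cube x₀ hr.le).measure_lt_top.ne
    have hmeas : AEStronglyMeasurable (fun x => Real.exp (l * (f x - essInfOn f (cube x₀ r))))
        (volume.restrict (cube x₀ r)) := by
      have := hf.aestronglyMeasurable.restrict (s := cube x₀ r)
      exact Real.continuous_exp.comp_aestronglyMeasurable
        ((this.sub aestronglyMeasurable_const).const_mul l)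
    have hnn : 0 ≤ᵐ[volume.restrict (cube x₀ r)]
        fun x => Real.exp (l * (f x - essInfOn f (cube x₀ r))) :=
      Eventually.of_forall fun x => (Real.exp_pos _).le
    refine ⟨⟨hmeas, ?_⟩, ?_⟩
    · rw [hasFiniteIntegral_iff_ofReal hnn]
      exact hlint.trans_lt (ENNReal.mul_lt_top ENNReal.ofReal_lt_top hfin.lt_top)
    · rw [integral_eq_lintegral_of_nonneg_ae hnn hmeas]
      refine (ENNReal.toReal_mono (ENNReal.mul_ne_top ENNReal.ofReal_ne_top hfin) hlint).trans ?_
      rw [ENNReal.toReal_mul, ENNReal.toReal_ofReal (by norm_num)]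
      rfl
  · intro c' R' hR' _
    have := ae_essInfOn_le (hbdd (WithLp.toLp 2 c') (2 * R') (by positivity))
    have h2 := (hmp.restrict_preimage_emb hemb (cube (WithLp.toLp 2 c') (2 * R'))
      ).quasiMeasurePreserving.ae this
    rwa [hcube c' R' hR'.le] at h2
  · intro c₁ R₁ c₂ R₂ hR₁ hR₂ h12 _
    exact essInfOn_cube_mono hf (hbdd _ _ (by positivity)) (by positivity)
      (hsubset _ _ _ _ hR₂ h12)
  · intro c' R' hR' h
    have hsub := hsubset _ _ _ _ hR' h
    rw [hx₀, hr2] at hsub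
    have hR2 : 0 < 2 * R' := by positivity
    have h1 := havg (WithLp.toLp 2 c') (2 * R') hR2 hsub
    have hpos := volumeReal_cube_pos (WithLp.toLp 2 c' : EuclideanSpace ℝ (Fin d)) hR2
    have hc := isCompact_cube (WithLp.toLp 2 c' : EuclideanSpace ℝ (Fin d)) hR2.le
    have h2 : ⨍ x in closedBall c' R', f (WithLp.toLp 2 x) =
        ⨍ x in cube (WithLp.toLp 2 c') (2 * R'), f x := by
      rw [setAverage_eq, setAverage_eq, ← hcube c' R' hR'.le,
        hmp.setIntegral_preimage_emb hemb f, measureReal_def, measureReal_def,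
        hmp.measure_preimage_emb hemb]
    rw [setAverage_eq, integral_sub (hf.integrableOn_isCompact hc) (integrable_const_iff.2 (Or.inr
      (by rw [isFiniteMeasure_restrict]; exact hc.measure_lt_top.ne))), setIntegral_const,
      smul_sub, ← setAverage_eq, smul_smul, inv_mul_cancel₀ hpos.ne', one_smul] at h1
    rw [h2]
    linarith

/-! ### The John–Nirenberg inequality with a critical radius function -/

/-- The defining inequality is closed in the constant, so the infimum still satisfies it, even when
it is `0`. -/
theorem setAverage_le_bloNorm {d : ℕ} {ρ : EuclideanSpace ℝ (Fin d) → ℝ} (hρ : ∀ x, 0 < ρ x)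
    {θ : ℝ} {f : EuclideanSpace ℝ (Fin d) → ℝ} (hf : MemBLO ρ θ f)
    (x₀ : EuclideanSpace ℝ (Fin d)) {r : ℝ} (hr : 0 < r) :
    ⨍ x in cube x₀ r, (f x - essInfOn f (cube x₀ r)) ≤ bloNorm ρ θ f * (1 + r / ρ x₀) ^ θ := by
  have hw : 0 < (1 + r / ρ x₀) ^ θ := Real.rpow_pos_of_pos (by have := hρ x₀; positivity) _
  rw [← div_le_iff₀ hw]
  obtain ⟨c, hc⟩ := hf.2
  refine le_csInf ⟨c, hc⟩ fun b hb => ?_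
  rw [div_le_iff₀ hw]
  exact (hb.2 x₀ r hr).2

theorem bloNorm_nonneg {d : ℕ} {ρ : EuclideanSpace ℝ (Fin d) → ℝ} {θ : ℝ}
    {f : EuclideanSpace ℝ (Fin d) → ℝ} : 0 ≤ bloNorm ρ θ f :=
  Real.sInf_nonneg fun _ hc => hc.1.le

/-- On subcubes of a cube the weight `1 + r / ρ` is controlled by a power of its value on the
cube. -/
theorem one_add_div_le_of_mem_cube {d : ℕ} {ρ : EuclideanSpace ℝ (Fin d) → ℝ}
    (hρ : ∀ x, 0 < ρ x) {C₀ N₀ : ℝ} (h : ComparisonConstants ρ C₀ N₀)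
    {x₀ y : EuclideanSpace ℝ (Fin d)} {r s : ℝ} (hr : 0 < r) (hs : s ≤ r)
    (hy : y ∈ cube x₀ r) :
    1 + s / ρ y ≤ C₀ * (d + 1) ^ N₀ * (1 + r / ρ x₀) ^ (N₀ + 1) := by
  obtain ⟨hC, hN, hcomp⟩ := h
  have hx := hρ x₀
  have hy' := hρ y
  set u := r / ρ x₀ with hu
  have hu0 : 0 < u := by positivity
  have hd1 : (1 : ℝ) ≤ d + 1 := by have : (0 : ℝ) ≤ d := Nat.cast_nonneg d; linarith
  have h1 := (hcomp x₀ y).1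
  have hT : 1 + ‖x₀ - y‖ / ρ x₀ ≤ (d + 1) * (1 + u) := by
    have : ‖x₀ - y‖ / ρ x₀ ≤ (d + 1) * u := by
      rw [hu, ← mul_div_assoc]
      gcongr
      exact norm_sub_le_of_mem_cube hr.le hy
    linarith
  have hT0 : 0 < 1 + ‖x₀ - y‖ / ρ x₀ := by positivity
  have h2 : ρ x₀ / ρ y ≤ C₀ * (1 + ‖x₀ - y‖ / ρ x₀) ^ N₀ := by
    rw [Real.rpow_neg hT0.le] at h1
    have hTN := Real.rpow_pos_of_pos hT0 N₀
    rw [div_le_iff₀ hy']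
    rw [le_div_iff₀ hx, one_div, ← mul_inv, inv_mul_le_iff₀ (by positivity)] at h1
    exact h1
  have h3 : (1 + ‖x₀ - y‖ / ρ x₀) ^ N₀ ≤ (d + 1) ^ N₀ * (1 + u) ^ N₀ := by
    rw [← Real.mul_rpow (by positivity) (by positivity)]
    exact Real.rpow_le_rpow hT0.le hT hN.le
  have h4 : s / ρ y ≤ u * (C₀ * ((d + 1) ^ N₀ * (1 + u) ^ N₀)) := by
    calc s / ρ y ≤ r / ρ y := by gcongr
      _ = u * (ρ x₀ / ρ y) := by rw [hu]; field_simp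
      _ ≤ u * (C₀ * (1 + ‖x₀ - y‖ / ρ x₀) ^ N₀) := by gcongr
      _ ≤ _ := by gcongr
  -- This absorbs the summand `1` into the same power, one more factor `1 + u` being available.
  have h5 : 1 ≤ C₀ * ((d + 1) ^ N₀ * (1 + u) ^ N₀) := by
    refine one_le_mul_of_one_le_of_one_le hC (one_le_mul_of_one_le_of_one_le ?_ ?_)
    · exact Real.one_le_rpow hd1 hN.le
    · exact Real.one_le_rpow (by linarith) hN.le
  rw [Real.rpow_add_one (by positivity)]
  linarith

theorem exists_integral_exp_le {d : ℕ} (hd : 0 < d) {ρ : EuclideanSpace ℝ (Fin d) → ℝ}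
    (hρ : ∀ x, 0 < ρ x) {C₀ N₀ : ℝ} (h : ComparisonConstants ρ C₀ N₀) {θ : ℝ} (hθ : 0 < θ) :
    ∃ C γ : ℝ, 0 < C ∧ 0 < γ ∧ ∀ f : EuclideanSpace ℝ (Fin d) → ℝ, MemBLO ρ θ f →
      ∀ (x₀ : EuclideanSpace ℝ (Fin d)) (r : ℝ), 0 < r →
        IntegrableOn (fun x => Real.exp ((1 + r / ρ x₀) ^ (-((N₀ + 1) * θ)) *
          (γ / bloNorm ρ θ f) * (f x - essInfOn f (cube x₀ r)))) (cube x₀ r) volume ∧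
        ∫ x in cube x₀ r, Real.exp ((1 + r / ρ x₀) ^ (-((N₀ + 1) * θ)) *
          (γ / bloNorm ρ θ f) * (f x - essInfOn f (cube x₀ r))) ≤
            C * volume.real (cube x₀ r) := by
  have hC : 0 < C₀ := zero_lt_one.trans_le h.1
  set C₁ : ℝ := C₀ * (d + 1) ^ N₀ with hC₁
  have hC₁pos : 0 < C₁ := by positivity
  have hC₁θ : 0 < C₁ ^ θ := Real.rpow_pos_of_pos hC₁pos _
  -- With `K` the largest weighted oscillation on subcubes, this `γ` makes `2 * l * 2 ^ d * K = 1`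
  -- when the seminorm is nonzero.
  refine ⟨6, 1 / (2 * 2 ^ d * C₁ ^ θ), by norm_num, by positivity, fun f hf x₀ r hr => ?_⟩
  set A := bloNorm ρ θ f with hA
  have hx := hρ x₀
  have hu : 0 < 1 + r / ρ x₀ := by positivity
  have hW : 0 < (1 + r / ρ x₀) ^ ((N₀ + 1) * θ) := Real.rpow_pos_of_pos hu _
  have hA0 : 0 ≤ A := bloNorm_nonneg
  have hbdd : ∀ y s, 0 < s → ∃ m : ℝ, ∀ᵐ x ∂(volume.restrict (cube y s)), m ≤ f x := by
    obtain ⟨c, hc⟩ := hf.2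
    exact fun y s hs => (hc.2 y s hs).1
  refine integral_exp_cube_le hf.1 (K := A * (C₁ ^ θ * (1 + r / ρ x₀) ^ ((N₀ + 1) * θ))) hr
    (by positivity) (by positivity) ?_ hbdd ?_
  · rw [Real.rpow_neg hu.le]
    rcases hA0.eq_or_lt with h0 | h0
    -- For a vanishing seminorm the quotient `γ / 0` is `0`, so the exponent is `0`.
    · simp [← h0]
    · refine le_of_eq ?_
      field_simp
  · intro y s hs hsub
    refine (setAverage_le_bloNorm hρ hf y hs).trans ?_
    refine mul_le_mul_of_nonneg_left ?_ hA0
    have hy : y ∈ cube x₀ r := hsub fun i => by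
      simpa using (half_pos hs).le
    -- The sides are compared through the volumes, which needs `0 < d`.
    have hsr : s ≤ r := by
      have hv : volume.real (cube y s) ≤ volume.real (cube x₀ r) :=
        measureReal_mono hsub (isCompact_cube x₀ hr.le).measure_lt_top.ne
      rw [measureReal_def, measureReal_def, volume_cube _ hs.le, volume_cube _ hr.le,
        Real.volume_pi_closedBall _ (by positivity), Real.volume_pi_closedBall _ (by positivity),
        ENNReal.toReal_ofReal (by positivity), ENNReal.toReal_ofReal (by positivity),
        Fintype.card_fin, pow_le_pow_iff_left₀ (by positivity) (by positivity) hd.ne'] at hv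
      linarith
    have h1 := one_add_div_le_of_mem_cube hρ h hr hsr hy
    have hy' := hρ y
    calc (1 + s / ρ y) ^ θ ≤ (C₁ * (1 + r / ρ x₀) ^ (N₀ + 1)) ^ θ :=
          Real.rpow_le_rpow (by positivity) h1 hθ.le
      _ = _ := by
          rw [Real.mul_rpow hC₁pos.le (Real.rpow_nonneg hu.le _), ← Real.rpow_mul hu.le]

/-! ### Reverse Hölder weights -/

theorem isProbabilityMeasure_normalized_ball {d : ℕ} (x : EuclideanSpace ℝ (Fin d)) {r : ℝ}
    (hr : 0 < r) :
    IsProbabilityMeasure ((volume (ball x r))⁻¹ • volume.restrict (ball x r)) := by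
  constructor
  rw [Measure.smul_apply, Measure.restrict_apply_univ, smul_eq_mul]
  exact ENNReal.inv_mul_cancel (measure_ball_pos _ _ hr).ne' measure_ball_lt_top.ne

theorem ReverseHolder.mono {d : ℕ} {s t : ℝ≥0∞} {V : EuclideanSpace ℝ (Fin d) → ℝ}
    (hV : LocallyIntegrable V) (hst : s ≤ t) (h : ReverseHolder t V) : ReverseHolder s V := by
  obtain ⟨C, hC, h⟩ := h
  refine ⟨C, hC, fun x r hr => le_trans ?_ (h x r hr)⟩
  have := isProbabilityMeasure_normalized_ball x hr
  exact eLpNorm_le_eLpNorm_of_exponent_le hst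
    ((hV.aestronglyMeasurable.restrict (s := ball x r)).smul_measure _)

theorem integrableOn_ball {d : ℕ} {V : EuclideanSpace ℝ (Fin d) → ℝ} (hV : LocallyIntegrable V)
    (x : EuclideanSpace ℝ (Fin d)) (r : ℝ) : IntegrableOn V (ball x r) :=
  (hV.integrableOn_isCompact (isCompact_closedBall x r)).mono_set ball_subset_closedBall

/-- The reverse Hölder inequality in terms of integrals. -/
theorem ReverseHolder.integral_rpow_le {d : ℕ} {p : ℝ} (hp : 1 < p)
    {V : EuclideanSpace ℝ (Fin d) → ℝ} (hV0 : ∀ x, 0 ≤ V x) (hV : LocallyIntegrable V)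
    (h : ReverseHolder (ENNReal.ofReal p) V) :
    ∃ C : ℝ, 0 < C ∧ ∀ (x : EuclideanSpace ℝ (Fin d)) (r : ℝ), 0 < r →
      MemLp V (ENNReal.ofReal p) (volume.restrict (ball x r)) ∧
      (∫ y in ball x r, V y ^ p) * volume.real (ball x r) ^ (p - 1) ≤
        (C * ∫ y in ball x r, V y) ^ p := by
  obtain ⟨C, hC, h⟩ := h
  refine ⟨C, hC, fun x r hr => ?_⟩
  have hp0 : 0 < p := by linarith
  have hv0 : volume (ball x r) ≠ 0 := (measure_ball_pos _ _ hr).ne'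
  have hvt : volume (ball x r) ≠ ∞ := measure_ball_lt_top.ne
  have hvpos : 0 < volume.real (ball x r) := ENNReal.toReal_pos hv0 hvt
  have hms := hV.aestronglyMeasurable.restrict (s := ball x r)
  have h1 := h x r hr
  have hmem : MemLp V (ENNReal.ofReal p) (volume.restrict (ball x r)) := by
    have h2 : MemLp V (ENNReal.ofReal p) ((volume (ball x r))⁻¹ • volume.restrict (ball x r)) :=
      ⟨hms.smul_measure _, h1.trans_lt ENNReal.ofReal_lt_top⟩
    have h3 := h2.smul_measure hvt
    rwa [smul_smul, ENNReal.mul_inv_cancel hv0 hvt, one_smul] at h3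
  refine ⟨hmem, ?_⟩
  have hW0 : 0 ≤ ∫ y in ball x r, V y := integral_nonneg hV0
  have hA0 : 0 ≤ C * ⨍ y in ball x r, V y := by
    rw [setAverage_eq, smul_eq_mul]
    positivity
  have hnu : ∫ y, V y ^ p ∂((volume (ball x r))⁻¹ • volume.restrict (ball x r)) ≤
      (C * ⨍ y in ball x r, V y) ^ p := by
    have hmem' := hmem.smul_measure (ENNReal.inv_ne_top.2 hv0)
    rw [hmem'.eLpNorm_eq_integral_rpow_norm (by simpa using hp0) ENNReal.ofReal_ne_top,
      ENNReal.toReal_ofReal hp0.le, ENNReal.ofReal_le_ofReal_iff] at h1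
    · simp_rw [Real.norm_of_nonneg (hV0 _)] at h1
      have h0 : 0 ≤ ∫ y, V y ^ p ∂((volume (ball x r))⁻¹ • volume.restrict (ball x r)) :=
        integral_nonneg fun y => Real.rpow_nonneg (hV0 y) _
      rwa [Real.rpow_inv_le_iff_of_pos h0 hA0 hp0] at h1
    · exact hA0
  rw [integral_smul_measure, setAverage_eq, smul_eq_mul, smul_eq_mul, ENNReal.toReal_inv,
    ← measureReal_def, inv_mul_le_iff₀ hvpos, mul_left_comm,
    Real.mul_rpow (inv_nonneg.2 hvpos.le) (by positivity), Real.inv_rpow hvpos.le] at hnu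
  rw [Real.rpow_sub_one hvpos.ne']
  have hvp := Real.rpow_pos_of_pos hvpos p
  calc _ ≤ (volume.real (ball x r) * ((volume.real (ball x r) ^ p)⁻¹ *
        (C * ∫ y in ball x r, V y) ^ p)) * (volume.real (ball x r) ^ p / volume.real (ball x r)) :=
        mul_le_mul_of_nonneg_right hnu (by positivity)
    _ = _ := by field_simp

/-- Hölder's inequality for the indicator function of a set of finite measure. -/
theorem integral_rpow_le_of_memLp {d : ℕ} {p : ℝ} (hp : 1 < p)
    {V : EuclideanSpace ℝ (Fin d) → ℝ} (hV0 : ∀ x, 0 ≤ V x)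
    {E : Set (EuclideanSpace ℝ (Fin d))} (hE : volume E ≠ ∞)
    (h : MemLp V (ENNReal.ofReal p) (volume.restrict E)) :
    (∫ y in E, V y) ^ p ≤ (∫ y in E, V y ^ p) * volume.real E ^ (p - 1) := by
  have hp0 : 0 < p := by linarith
  have hq := Real.HolderConjugate.conjExponent hp
  have : IsFiniteMeasure (volume.restrict E) := isFiniteMeasure_restrict.2 hE
  have h1 := integral_mul_le_Lp_mul_Lq_of_nonneg (μ := volume.restrict E) hq
    (f := V) (g := fun _ => 1) (Eventually.of_forall hV0) (Eventually.of_forall fun _ => zero_le_one)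
    h (memLp_const 1)
  simp only [mul_one, Real.one_rpow, integral_const, smul_eq_mul, measureReal_restrict_apply_univ]
    at h1
  have hW0 : 0 ≤ ∫ y in E, V y := integral_nonneg hV0
  have hn0 : 0 ≤ ∫ y in E, V y ^ p := integral_nonneg fun y => Real.rpow_nonneg (hV0 y) _
  calc _ ≤ ((∫ y in E, V y ^ p) ^ (1 / p) * volume.real E ^ (1 / p.conjExponent)) ^ p :=
        Real.rpow_le_rpow hW0 h1 hp0.le
    _ = _ := by
        rw [Real.mul_rpow (by positivity) (by positivity), ← Real.rpow_mul hn0,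
          ← Real.rpow_mul measureReal_nonneg]
        congr 2
        · rw [one_div_mul_cancel hp0.ne', Real.rpow_one]
        · rw [Real.conjExponent]; field_simp

/-! ### Growth of doubling functions -/

/-- A monotone function with the doubling property grows at most polynomially. -/
theorem exists_le_mul_rpow_of_doubling {D : ℝ} (hD : 1 < D) :
    ∃ a : ℝ, 0 < a ∧ ∀ g : ℝ → ℝ, (∀ r R, 0 < r → r ≤ R → g r ≤ g R) → (∀ r, 0 < r → 0 ≤ g r) →
      (∀ r, 0 < r → g (2 * r) ≤ D * g r) →
      ∀ r R, 0 < r → r ≤ R → g R ≤ D * (R / r) ^ a * g r := by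
  refine ⟨Real.logb 2 D, Real.logb_pos one_lt_two hD, fun g hmono h0 hdbl r R hr hrR => ?_⟩
  -- Rounding `R / r` up to a power of `2` costs the extra factor `D`.
  obtain ⟨n, hn1, hn2⟩ := exists_nat_pow_near ((one_le_div hr).2 hrR) one_lt_two
  rw [div_lt_iff₀ hr] at hn2
  have hDa : (2 : ℝ) ^ Real.logb 2 D = D := Real.rpow_logb two_pos (by norm_num) (by linarith)
  have hit : ∀ k : ℕ, g (2 ^ k * r) ≤ D ^ k * g r := by
    intro k
    induction k with
    | zero => simp
    | succ k ih =>
      calc g (2 ^ (k + 1) * r) = g (2 * (2 ^ k * r)) := by congr 1; ring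
        _ ≤ D * g (2 ^ k * r) := hdbl _ (by positivity)
        _ ≤ D * (D ^ k * g r) := by gcongr
        _ = _ := by ring
  have hDn : D ^ n ≤ (R / r) ^ Real.logb 2 D := by
    calc D ^ n = ((2 : ℝ) ^ n) ^ Real.logb 2 D := by
          rw [← Real.rpow_natCast 2 n, ← Real.rpow_mul two_pos.le, mul_comm,
            Real.rpow_mul two_pos.le, hDa, Real.rpow_natCast]
      _ ≤ _ := Real.rpow_le_rpow (by positivity) hn1 (Real.logb_pos one_lt_two hD).le
  calc g R ≤ g (2 ^ (n + 1) * r) := hmono _ _ (hr.trans_le hrR) hn2.le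
    _ ≤ D ^ (n + 1) * g r := hit _
    _ = D * D ^ n * g r := by ring
    _ ≤ _ := by have := h0 r hr; gcongr

/-- A monotone function with the reverse doubling property decays at least polynomially at `0`. -/
theorem exists_le_mul_rpow_of_reverse_doubling {κ : ℝ} (hκ0 : 0 < κ) (hκ : κ < 1) :
    ∃ δ : ℝ, 0 < δ ∧ ∀ g : ℝ → ℝ, (∀ r R, 0 < r → r ≤ R → g r ≤ g R) → (∀ r, 0 < r → 0 ≤ g r) →
      (∀ r, 0 < r → g (r / 4) ≤ κ * g r) →
      ∀ r R, 0 < r → r ≤ R → g r ≤ κ⁻¹ * (r / R) ^ δ * g R := by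
  have hδ : 0 < Real.logb 4 κ⁻¹ := Real.logb_pos (by norm_num) ((one_lt_inv₀ hκ0).2 hκ)
  refine ⟨Real.logb 4 κ⁻¹, hδ, fun g hmono h0 hrev r R hr hrR => ?_⟩
  have hR : 0 < R := hr.trans_le hrR
  obtain ⟨n, hn1, hn2⟩ := exists_nat_pow_near ((one_le_div hr).2 hrR) (by norm_num : (1 : ℝ) < 4)
  have hκa : (4 : ℝ) ^ Real.logb 4 κ⁻¹ = κ⁻¹ :=
    Real.rpow_logb (by norm_num) (by norm_num) (by positivity)
  have hit : ∀ k : ℕ, g (R / 4 ^ k) ≤ κ ^ k * g R := by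
    intro k
    induction k with
    | zero => simp
    | succ k ih =>
      calc g (R / 4 ^ (k + 1)) = g (R / 4 ^ k / 4) := by congr 1; field_simp; ring
        _ ≤ κ * g (R / 4 ^ k) := hrev _ (by positivity)
        _ ≤ κ * (κ ^ k * g R) := by gcongr
        _ = _ := by ring
  have hκn : κ ^ (n + 1) ≤ (r / R) ^ Real.logb 4 κ⁻¹ := by
    have h1 : (R / r) ^ Real.logb 4 κ⁻¹ ≤ (κ ^ (n + 1))⁻¹ := by
      calc (R / r) ^ Real.logb 4 κ⁻¹ ≤ ((4 : ℝ) ^ (n + 1)) ^ Real.logb 4 κ⁻¹ :=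
            Real.rpow_le_rpow (by positivity) hn2.le hδ.le
        _ = _ := by
            rw [← Real.rpow_natCast 4 (n + 1), ← Real.rpow_mul (by norm_num), mul_comm,
              Real.rpow_mul (by norm_num), hκa, Real.rpow_natCast, inv_pow]
    rw [← inv_div R r, Real.inv_rpow (by positivity)]
    exact (le_inv_comm₀ (Real.rpow_pos_of_pos (by positivity) _) (by positivity)).1 h1
  calc g r ≤ g (R / 4 ^ n) := by
        refine hmono _ _ hr ?_
        rw [le_div_iff₀ (by positivity)]
        rw [le_div_iff₀ hr] at hn1
        linarith
    _ ≤ κ ^ n * g R := hit _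
    _ = κ⁻¹ * κ ^ (n + 1) * g R := by rw [pow_succ]; field_simp
    _ ≤ _ := by have := h0 R hR; gcongr

/-! ### Doubling of reverse Hölder weights -/

theorem volumeReal_ball {d : ℕ} (x : EuclideanSpace ℝ (Fin d)) {r : ℝ} (hr : 0 < r) :
    volume.real (ball x r) = r ^ d * volume.real (ball (0 : EuclideanSpace ℝ (Fin d)) 1) := by
  rw [measureReal_def, Measure.addHaar_ball_of_pos _ _ hr, ENNReal.toReal_mul,
    ENNReal.toReal_ofReal (by positivity), finrank_euclideanSpace_fin, measureReal_def]

theorem volumeReal_ball_pos {d : ℕ} (x : EuclideanSpace ℝ (Fin d)) {r : ℝ} (hr : 0 < r) :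
    0 < volume.real (ball x r) :=
  ENNReal.toReal_pos (measure_ball_pos _ _ hr).ne' measure_ball_lt_top.ne

theorem integrableOn_rpow_of_memLp {d : ℕ} {p : ℝ} (hp : 0 < p)
    {V : EuclideanSpace ℝ (Fin d) → ℝ} (hV0 : ∀ x, 0 ≤ V x) {E : Set (EuclideanSpace ℝ (Fin d))}
    (h : MemLp V (ENNReal.ofReal p) (volume.restrict E)) :
    IntegrableOn (fun y => V y ^ p) E := by
  have := h.integrable_norm_rpow (by simpa using hp) ENNReal.ofReal_ne_top
  simp_rw [ENNReal.toReal_ofReal hp.le, Real.norm_of_nonneg (hV0 _)] at this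
  exact this

/-- A thin shell `B(x, r) \ B(x, a r)` of relative volume `η` carries at most half of the mass, by
Hölder's inequality on the shell and the reverse Hölder inequality on the ball. So shrinking by `a`
at most halves the mass, and finitely many such steps shrink by more than `2`. -/
theorem exists_doubling {d : ℕ} (hd : 0 < d) {p C : ℝ} (hp : 1 < p) (hC : 0 < C)
    {V : EuclideanSpace ℝ (Fin d) → ℝ} (hV0 : ∀ x, 0 ≤ V x) (hV : LocallyIntegrable V)
    (hRH : ∀ (x : EuclideanSpace ℝ (Fin d)) (r : ℝ), 0 < r →
      MemLp V (ENNReal.ofReal p) (volume.restrict (ball x r)) ∧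
      (∫ y in ball x r, V y ^ p) * volume.real (ball x r) ^ (p - 1) ≤
        (C * ∫ y in ball x r, V y) ^ p) :
    ∃ D : ℝ, 1 < D ∧ ∀ (x : EuclideanSpace ℝ (Fin d)) (r : ℝ), 0 < r →
      ∫ y in ball x (2 * r), V y ≤ D * ∫ y in ball x r, V y := by
  have hp0 : 0 < p := by linarith
  obtain ⟨η, hη0, hη1, hη⟩ : ∃ η : ℝ, 0 < η ∧ η < 1 ∧ C ^ p * η ^ (p - 1) ≤ (1 / 2) ^ p := by
    have hlim : Tendsto (fun η : ℝ => C ^ p * η ^ (p - 1)) (𝓝[>] 0) (𝓝 0) := by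
      have h1 : Tendsto (fun η : ℝ => C ^ p * η ^ (p - 1)) (𝓝 0)
          (𝓝 (C ^ p * (0 : ℝ) ^ (p - 1))) :=
        ((Real.continuousAt_rpow_const 0 (p - 1) (Or.inr (by linarith))).tendsto).const_mul _
      rw [Real.zero_rpow (by linarith), mul_zero] at h1
      exact h1.mono_left nhdsWithin_le_nhds
    have h2 := hlim.eventually (gt_mem_nhds (Real.rpow_pos_of_pos (one_half_pos (α := ℝ)) p))
    obtain ⟨η, h3, h4, h5⟩ := (h2.and (Ioo_mem_nhdsGT (zero_lt_one' ℝ))).exists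
    exact ⟨η, h4, h5, h3.le⟩
  -- Chosen so that the shell has exactly the proportion `η` of the volume.
  set a : ℝ := (1 - η) ^ (1 / (d : ℝ)) with ha
  have hd' : (0 : ℝ) < d := Nat.cast_pos.2 hd
  have ha0 : 0 < a := Real.rpow_pos_of_pos (by linarith) _
  have ha1 : a < 1 := Real.rpow_lt_one (by linarith) (by linarith) (by positivity)
  have had : a ^ d = 1 - η := by
    rw [ha, ← Real.rpow_natCast, ← Real.rpow_mul (by linarith), one_div_mul_cancel hd'.ne',
      Real.rpow_one]
  have hstep : ∀ (x : EuclideanSpace ℝ (Fin d)) (r : ℝ), 0 < r →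
      ∫ y in ball x r, V y ≤ 2 * ∫ y in ball x (a * r), V y := by
    intro x r hr
    have har : 0 < a * r := by positivity
    have hsub : ball x (a * r) ⊆ ball x r := ball_subset_ball (by nlinarith)
    have hE : volume.real (ball x r \ ball x (a * r)) = η * volume.real (ball x r) := by
      rw [measureReal_sdiff hsub measurableSet_ball (measure_ball_lt_top.ne), volumeReal_ball x hr,
        volumeReal_ball x har, mul_pow, had]
      ring
    have hEtop : volume (ball x r \ ball x (a * r)) ≠ ∞ :=
      ((measure_mono Set.sdiff_subset).trans_lt measure_ball_lt_top).ne
    obtain ⟨hmem, hrh⟩ := hRH x r hr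
    have h1 := integral_rpow_le_of_memLp hp hV0 hEtop
      (hmem.mono_measure (Measure.restrict_mono_set _ Set.sdiff_subset))
    have hsplit : ∫ y in ball x r \ ball x (a * r), V y =
        (∫ y in ball x r, V y) - ∫ y in ball x (a * r), V y :=
      setIntegral_sdiff measurableSet_ball (integrableOn_ball hV x r) hsub
    have hW0 : 0 ≤ ∫ y in ball x r, V y := integral_nonneg hV0
    have hpint := integrableOn_rpow_of_memLp hp0 hV0 hmem
    have h2 : ∫ y in ball x r \ ball x (a * r), V y ^ p ≤ ∫ y in ball x r, V y ^ p :=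
      setIntegral_mono_set hpint (Eventually.of_forall fun y => Real.rpow_nonneg (hV0 y) _)
        Set.sdiff_subset.eventuallyLE
    have h3 : (∫ y in ball x r \ ball x (a * r), V y) ^ p ≤
        (1 / 2 * ∫ y in ball x r, V y) ^ p := by
      rw [hE, Real.mul_rpow hη0.le measureReal_nonneg] at h1
      have hηp : 0 < η ^ (p - 1) := Real.rpow_pos_of_pos hη0 _
      calc _ ≤ _ := h1
        _ ≤ (∫ y in ball x r, V y ^ p) * (η ^ (p - 1) * volume.real (ball x r) ^ (p - 1)) := by
            gcongr
        _ = ((∫ y in ball x r, V y ^ p) * volume.real (ball x r) ^ (p - 1)) * η ^ (p - 1) := by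
            ring
        _ ≤ (C * ∫ y in ball x r, V y) ^ p * η ^ (p - 1) := by gcongr
        _ = (C ^ p * η ^ (p - 1)) * (∫ y in ball x r, V y) ^ p := by
            rw [Real.mul_rpow hC.le hW0]; ring
        _ ≤ (1 / 2) ^ p * (∫ y in ball x r, V y) ^ p := by gcongr
        _ = _ := (Real.mul_rpow (by norm_num) hW0).symm
    rw [Real.rpow_le_rpow_iff (integral_nonneg hV0) (by positivity) hp0, hsplit] at h3
    linarith
  obtain ⟨k, hk⟩ := exists_pow_lt_of_lt_one (one_half_pos (α := ℝ)) ha1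
  have hiter : ∀ (n : ℕ) (x : EuclideanSpace ℝ (Fin d)) (r : ℝ), 0 < r →
      ∫ y in ball x r, V y ≤ 2 ^ n * ∫ y in ball x (a ^ n * r), V y := by
    intro n
    induction n with
    | zero => intro x r _; simp
    | succ n ih =>
      intro x r hr
      refine (ih x r hr).trans ?_
      rw [pow_succ, mul_assoc, pow_succ', mul_assoc]
      gcongr
      exact hstep x _ (by positivity)
  refine ⟨2 ^ (k + 1), one_lt_pow₀ one_lt_two (by simp), fun x r hr => ?_⟩
  have hW0 : 0 ≤ ∫ y in ball x r, V y := integral_nonneg hV0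
  refine (hiter k x (2 * r) (by positivity)).trans ?_
  refine mul_le_mul (pow_le_pow_right₀ one_le_two (by simp)) ?_ (integral_nonneg hV0)
    (by positivity)
  refine setIntegral_mono_set (integrableOn_ball hV x r) (Eventually.of_forall hV0)
    (ball_subset_ball ?_).eventuallyLE
  nlinarith

/-- The scale invariant mean `r ^ (2 - d) * ∫_{B(x, r)} V` defining the critical radius. -/
def scaledMass {d : ℕ} (V : EuclideanSpace ℝ (Fin d) → ℝ) (x : EuclideanSpace ℝ (Fin d))
    (r : ℝ) : ℝ :=
  1 / r ^ (d - 2) * ∫ y in ball x r, V y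

theorem scaledMass_nonneg {d : ℕ} {V : EuclideanSpace ℝ (Fin d) → ℝ} (hV0 : ∀ x, 0 ≤ V x)
    (x : EuclideanSpace ℝ (Fin d)) {r : ℝ} (hr : 0 < r) : 0 ≤ scaledMass V x r :=
  mul_nonneg (by positivity) (integral_nonneg hV0)

theorem setIntegral_ball_mono {d : ℕ} {V : EuclideanSpace ℝ (Fin d) → ℝ} (hV0 : ∀ x, 0 ≤ V x)
    {x y : EuclideanSpace ℝ (Fin d)} {r R : ℝ} (hV : IntegrableOn V (ball y R))
    (h : ball x r ⊆ ball y R) : ∫ z in ball x r, V z ≤ ∫ z in ball y R, V z :=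
  setIntegral_mono_set hV (Eventually.of_forall hV0) h.eventuallyLE

/-- A doubling density has the reverse doubling property. -/
theorem exists_reverse_doubling {d : ℕ} (hd : 0 < d) {D : ℝ} (hD : 1 < D)
    {U : EuclideanSpace ℝ (Fin d) → ℝ} (hU0 : ∀ x, 0 ≤ U x)
    (hU : ∀ x r, 0 < r → IntegrableOn U (ball x r))
    (hdbl : ∀ x r, 0 < r → ∫ y in ball x (2 * r), U y ≤ D * ∫ y in ball x r, U y) :
    ∃ κ : ℝ, 0 < κ ∧ κ < 1 ∧ ∀ x r, 0 < r →
      ∫ y in ball x (r / 4), U y ≤ κ * ∫ y in ball x r, U y := by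
  have hD0 : 0 < D := by linarith
  refine ⟨1 - (D ^ 3)⁻¹, sub_pos.2 (inv_lt_one_of_one_lt₀ (one_lt_pow₀ hD (by simp))),
    sub_lt_self _ (by positivity), fun x r hr => ?_⟩
  have : Nonempty (Fin d) := ⟨⟨0, hd⟩⟩
  -- The ball of radius `r / 4` about a point at distance `r / 2` lies in `B(x, r)`, misses `B(x, r
  -- / 4)` and, after three doublings, carries at least the share `D⁻³` of the mass.
  obtain ⟨e, he⟩ := exists_norm_eq (EuclideanSpace ℝ (Fin d)) (half_pos hr).le
  set z := x + e with hz
  have hxz : dist z x = r / 2 := by rw [hz, dist_eq_norm]; simpa using he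
  have h1 : ∫ y in ball x r, U y ≤ ∫ y in ball z (2 * r), U y :=
    setIntegral_ball_mono hU0 (hU _ _ (by positivity))
      (ball_subset_ball' (by rw [dist_comm, hxz]; linarith))
  have h2 : ∫ y in ball z (2 * r), U y ≤ D ^ 3 * ∫ y in ball z (r / 4), U y := by
    have e1 := hdbl z r hr
    have e2 := hdbl z (r / 2) (by positivity)
    have e3 := hdbl z (r / 4) (by positivity)
    rw [show 2 * (r / 2) = r by ring] at e2
    rw [show 2 * (r / 4) = r / 2 by ring] at e3
    calc _ ≤ _ := e1
      _ ≤ D * (D * (D * ∫ y in ball z (r / 4), U y)) := by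
        gcongr
        exact e2.trans (by gcongr)
      _ = _ := by ring
  have hdisj : Disjoint (ball x (r / 4)) (ball z (r / 4)) :=
    ball_disjoint_ball (by rw [dist_comm, hxz]; linarith)
  have h3 : (∫ y in ball x (r / 4), U y) + ∫ y in ball z (r / 4), U y ≤ ∫ y in ball x r, U y := by
    rw [← setIntegral_union hdisj measurableSet_ball (hU _ _ (by positivity))
      (hU _ _ (by positivity))]
    refine setIntegral_mono_set (hU x r hr) (Eventually.of_forall hU0)
      (Set.union_subset (ball_subset_ball (by linarith)) (ball_subset_ball' ?_)).eventuallyLE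
    rw [hxz]; linarith
  have h4 : (D ^ 3)⁻¹ * ∫ y in ball x r, U y ≤ ∫ y in ball z (r / 4), U y := by
    rw [inv_mul_le_iff₀ (by positivity)]
    exact h1.trans h2
  rw [sub_mul, one_mul]
  linarith

/-- For `p = d / 2` one has `d (p - 1) = (d - 2) p`, so the volume factors in both Hölder
inequalities cancel the scaling: `scaledMass ^ p` is comparable to `∫ V ^ p` uniformly in the ball.
Doubling of `V` thereby passes to `V ^ p`, and reverse doubling of `V ^ p` passes back as decay of
the scaled mass. -/
theorem exists_growth_of_reverseHolder {d : ℕ} (hd : 3 ≤ d) {V : EuclideanSpace ℝ (Fin d) → ℝ}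
    (hV0 : ∀ x, 0 ≤ V x) (hV : LocallyIntegrable V)
    (hRH : ReverseHolder (ENNReal.ofReal (d / 2)) V) :
    ∃ D a B δ : ℝ, 1 < D ∧ 0 < a ∧ 0 < B ∧ 0 < δ ∧
      (∀ x r R, 0 < r → r ≤ R →
        ∫ y in ball x R, V y ≤ D * (R / r) ^ a * ∫ y in ball x r, V y) ∧
      (∀ x r R, 0 < r → r ≤ R →
        scaledMass V x r ≤ B * (r / R) ^ δ * scaledMass V x R) := by
  have hd3 : (3 : ℝ) ≤ d := by exact_mod_cast hd
  set p : ℝ := d / 2 with hpdef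
  have hp : 1 < p := by rw [hpdef]; linarith
  have hp0 : 0 < p := by linarith
  obtain ⟨C, hC, hRH⟩ := hRH.integral_rpow_le hp hV0 hV
  obtain ⟨D, hD, hdbl⟩ := exists_doubling (by omega) hp hC hV0 hV hRH
  have hD0 : 0 < D := by linarith
  obtain ⟨a, ha, hgrow⟩ := exists_le_mul_rpow_of_doubling hD
  set ω := volume.real (ball (0 : EuclideanSpace ℝ (Fin d)) 1) with hω
  have hω0 : 0 < ω := volumeReal_ball_pos _ one_pos
  have hωp : 0 < ω ^ (p - 1) := Real.rpow_pos_of_pos hω0 _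
  have hν0 : ∀ x (r : ℝ), 0 ≤ ∫ y in ball x r, V y ^ p := fun x r =>
    integral_nonneg fun y => Real.rpow_nonneg (hV0 y) _
  have hνint : ∀ x (r : ℝ), 0 < r → IntegrableOn (fun y => V y ^ p) (ball x r) := fun x r hr =>
    integrableOn_rpow_of_memLp hp0 hV0 (hRH x r hr).1
  have hvol : ∀ (x : EuclideanSpace ℝ (Fin d)) (r : ℝ), 0 < r →
      volume.real (ball x r) ^ (p - 1) = (r ^ (d - 2)) ^ p * ω ^ (p - 1) := by
    intro x r hr
    rw [volumeReal_ball x hr, Real.mul_rpow (by positivity) hω0.le, ← Real.rpow_natCast r d,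
      ← Real.rpow_natCast r (d - 2), ← Real.rpow_mul hr.le, ← Real.rpow_mul hr.le]
    congr 2
    rw [Nat.cast_sub (by omega), hpdef]
    push_cast
    ring
  have hφ : ∀ (x : EuclideanSpace ℝ (Fin d)) (r : ℝ), 0 < r →
      scaledMass V x r ^ p * (r ^ (d - 2)) ^ p = (∫ y in ball x r, V y) ^ p := by
    intro x r hr
    rw [← Real.mul_rpow (scaledMass_nonneg hV0 x hr) (by positivity), scaledMass]
    congr 1
    field_simp
  have hup : ∀ (x : EuclideanSpace ℝ (Fin d)) (r : ℝ), 0 < r →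
      scaledMass V x r ^ p ≤ ω ^ (p - 1) * ∫ y in ball x r, V y ^ p := by
    intro x r hr
    have h1 := integral_rpow_le_of_memLp hp hV0 measure_ball_lt_top.ne (hRH x r hr).1
    rw [hvol x r hr, ← hφ x r hr] at h1
    have : 0 < (r ^ (d - 2)) ^ p := by positivity
    refine le_of_mul_le_mul_right ?_ this
    linarith
  have hlow : ∀ (x : EuclideanSpace ℝ (Fin d)) (r : ℝ), 0 < r →
      ω ^ (p - 1) * ∫ y in ball x r, V y ^ p ≤ C ^ p * scaledMass V x r ^ p := by
    intro x r hr
    have h1 := (hRH x r hr).2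
    rw [hvol x r hr, Real.mul_rpow hC.le (integral_nonneg hV0), ← hφ x r hr] at h1
    have : 0 < (r ^ (d - 2)) ^ p := by positivity
    refine le_of_mul_le_mul_right ?_ this
    linarith
  have hνdbl : ∀ x r, 0 < r → ∫ y in ball x (2 * r), V y ^ p ≤
      (1 + (C * D) ^ p) * ∫ y in ball x r, V y ^ p := by
    intro x r hr
    have h1 : scaledMass V x (2 * r) ≤ D * scaledMass V x r := by
      have h2 : 1 / (2 * r) ^ (d - 2) ≤ 1 / r ^ (d - 2) := by
        gcongr
        linarith
      calc scaledMass V x (2 * r) ≤ 1 / r ^ (d - 2) * (D * ∫ y in ball x r, V y) :=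
            mul_le_mul h2 (hdbl x r hr) (integral_nonneg hV0) (by positivity)
        _ = _ := by rw [scaledMass]; ring
    have h3 : ω ^ (p - 1) * ∫ y in ball x (2 * r), V y ^ p ≤
        ω ^ (p - 1) * ((C * D) ^ p * ∫ y in ball x r, V y ^ p) := by
      calc _ ≤ C ^ p * scaledMass V x (2 * r) ^ p := hlow x _ (by positivity)
        _ ≤ C ^ p * (D * scaledMass V x r) ^ p := by
            have := scaledMass_nonneg hV0 x (r := 2 * r) (by positivity)
            gcongr
        _ = (C * D) ^ p * scaledMass V x r ^ p := by
            rw [Real.mul_rpow hD0.le (scaledMass_nonneg hV0 x hr), Real.mul_rpow hC.le hD0.le]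
            ring
        _ ≤ (C * D) ^ p * (ω ^ (p - 1) * ∫ y in ball x r, V y ^ p) := by
            gcongr
            exact hup x r hr
        _ = _ := by ring
    have h4 := le_of_mul_le_mul_left h3 hωp
    have := hν0 x r
    linarith
  obtain ⟨κ, hκ0, hκ1, hrev⟩ := exists_reverse_doubling (by omega)
    (by have : 0 < (C * D) ^ p := by positivity
        linarith) (fun x => Real.rpow_nonneg (hV0 x) p) hνint hνdbl
  obtain ⟨δ, hδ, hdec⟩ := exists_le_mul_rpow_of_reverse_doubling hκ0 hκ1
  -- The last two constants come from taking `p`-th roots.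
  refine ⟨D, a, (κ⁻¹ * C ^ p) ^ (1 / p), δ / p, hD, ha, by positivity, by positivity, ?_, ?_⟩
  · intro x
    exact hgrow (fun r => ∫ y in ball x r, V y)
      (fun r R _ hrR => setIntegral_ball_mono hV0 (integrableOn_ball hV x R) (ball_subset_ball hrR))
      (fun r _ => integral_nonneg hV0) (hdbl x)
  · intro x r R hr hrR
    have hR : 0 < R := hr.trans_le hrR
    have h1 := hdec (fun r => ∫ y in ball x r, V y ^ p)
      (fun r R hr hrR => setIntegral_ball_mono (fun y => Real.rpow_nonneg (hV0 y) p)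
        (hνint x R (hr.trans_le hrR)) (ball_subset_ball hrR))
      (fun r _ => hν0 x r) (hrev x) r R hr hrR
    have hS := scaledMass_nonneg hV0 x hr
    have hS' := scaledMass_nonneg hV0 x hR
    rw [← Real.rpow_le_rpow_iff hS (by positivity) hp0, Real.mul_rpow (by positivity) hS',
      Real.mul_rpow (by positivity) (by positivity), ← Real.rpow_mul (by positivity),
      ← Real.rpow_mul (by positivity), one_div_mul_cancel hp0.ne', div_mul_cancel₀ _ hp0.ne',
      Real.rpow_one]
    calc _ ≤ ω ^ (p - 1) * ∫ y in ball x r, V y ^ p := hup x r hr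
      _ ≤ ω ^ (p - 1) * (κ⁻¹ * (r / R) ^ δ * ∫ y in ball x R, V y ^ p) := by gcongr
      _ = κ⁻¹ * (r / R) ^ δ * (ω ^ (p - 1) * ∫ y in ball x R, V y ^ p) := by ring
      _ ≤ κ⁻¹ * (r / R) ^ δ * (C ^ p * scaledMass V x R ^ p) := by
          exact mul_le_mul_of_nonneg_left (hlow x R hR) (by positivity)
      _ = _ := by ring

/-! ### The critical radius -/

/-- If one ball had no mass, polynomial growth would leave no mass in any concentric larger ball,
and these exhaust the space. -/
theorem setIntegral_ball_pos {d : ℕ} {V : EuclideanSpace ℝ (Fin d) → ℝ} (hV0 : ∀ x, 0 ≤ V x)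
    (hV : LocallyIntegrable V) (hV_ne : ¬ ∀ᵐ x, V x = 0) {D a : ℝ}
    (hgrow : ∀ x r R, 0 < r → r ≤ R →
      ∫ y in ball x R, V y ≤ D * (R / r) ^ a * ∫ y in ball x r, V y)
    (x : EuclideanSpace ℝ (Fin d)) {r : ℝ} (hr : 0 < r) : 0 < ∫ y in ball x r, V y := by
  refine lt_of_le_of_ne (integral_nonneg hV0) fun h0 => hV_ne ?_
  have h1 : ∀ n : ℕ, ∀ᵐ y, y ∈ ball x (r + n) → V y = 0 := by
    intro n
    have h2 := hgrow x r (r + n) hr (by simp)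
    rw [← h0, mul_zero] at h2
    have h3 := le_antisymm h2 (integral_nonneg hV0)
    rw [setIntegral_eq_zero_iff_of_nonneg_ae (Eventually.of_forall hV0)
      (integrableOn_ball hV x _)] at h3
    exact (ae_restrict_iff' measurableSet_ball).1 h3
  filter_upwards [ae_all_iff.2 h1] with y hy
  obtain ⟨n, hn⟩ := exists_nat_gt (dist y x)
  exact hy n (mem_ball.2 (by linarith))

theorem scaledMass_le_one {d : ℕ} {V : EuclideanSpace ℝ (Fin d) → ℝ} {B δ : ℝ} (hδ : 0 < δ)
    (hdec : ∀ x r R, 0 < r → r ≤ R → scaledMass V x r ≤ B * (r / R) ^ δ * scaledMass V x R)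
    (x : EuclideanSpace ℝ (Fin d)) {M T : ℝ} (hM : 0 < M) (hT : 1 ≤ T)
    (hMT : B * scaledMass V x M ≤ T) : scaledMass V x (M * T ^ (-(1 / δ))) ≤ 1 := by
  have hT0 : 0 < T := by linarith
  have hTδ : 0 < T ^ (-(1 / δ)) := Real.rpow_pos_of_pos hT0 _
  have h1 : T ^ (-(1 / δ)) ≤ 1 := Real.rpow_le_one_of_one_le_of_nonpos hT
    (neg_nonpos.2 (by positivity))
  refine (hdec x _ M (by positivity) (mul_le_of_le_one_right hM.le h1)).trans ?_
  rw [mul_div_cancel_left₀ _ hM.ne', ← Real.rpow_mul hT0.le, neg_mul, one_div_mul_cancel hδ.ne',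
    Real.rpow_neg_one, mul_right_comm]
  exact (mul_inv_le_iff₀ hT0).2 (by linarith)

theorem bddAbove_scaledMass_le_one {d : ℕ} {V : EuclideanSpace ℝ (Fin d) → ℝ} {B δ : ℝ}
    (hB : 0 < B) (hδ : 0 < δ)
    (hdec : ∀ x r R, 0 < r → r ≤ R → scaledMass V x r ≤ B * (r / R) ^ δ * scaledMass V x R)
    {x : EuclideanSpace ℝ (Fin d)} (hpos : 0 < scaledMass V x 1) :
    BddAbove {r : ℝ | 0 < r ∧ scaledMass V x r ≤ 1} := by
  refine ⟨max 1 ((B / scaledMass V x 1) ^ (1 / δ)), fun r hr => ?_⟩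
  obtain ⟨hr0, hr1⟩ := hr
  rcases le_total r 1 with h | h
  · exact h.trans (le_max_left _ _)
  · refine le_trans ?_ (le_max_right _ _)
    have hrδ : 0 < r ^ δ := Real.rpow_pos_of_pos hr0 _
    have h1 : scaledMass V x 1 ≤ B * (1 / r) ^ δ * 1 :=
      (hdec x 1 r one_pos h).trans (by gcongr)
    rw [mul_one, one_div, Real.inv_rpow hr0.le, ← div_eq_mul_inv, le_div_iff₀ hrδ] at h1
    calc r = (r ^ δ) ^ (1 / δ) := by
          rw [← Real.rpow_mul hr0.le, mul_one_div_cancel hδ.ne', Real.rpow_one]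
      _ ≤ _ := by
          gcongr
          rw [le_div_iff₀ hpos]
          linarith

theorem le_criticalRadius {d : ℕ} {V : EuclideanSpace ℝ (Fin d) → ℝ} {B δ : ℝ}
    (hB : 0 < B) (hδ : 0 < δ)
    (hdec : ∀ x r R, 0 < r → r ≤ R → scaledMass V x r ≤ B * (r / R) ^ δ * scaledMass V x R)
    {x : EuclideanSpace ℝ (Fin d)} (hpos : 0 < scaledMass V x 1) {M T : ℝ} (hM : 0 < M)
    (hT : 1 ≤ T) (hMT : B * scaledMass V x M ≤ T) :
    M * T ^ (-(1 / δ)) ≤ criticalRadius V x :=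
  le_csSup (bddAbove_scaledMass_le_one hB hδ hdec hpos)
    ⟨mul_pos hM (Real.rpow_pos_of_pos (by linarith) _), scaledMass_le_one hδ hdec x hM hT hMT⟩

theorem criticalRadius_pos {d : ℕ} {V : EuclideanSpace ℝ (Fin d) → ℝ} {B δ : ℝ}
    (hB : 0 < B) (hδ : 0 < δ)
    (hdec : ∀ x r R, 0 < r → r ≤ R → scaledMass V x r ≤ B * (r / R) ^ δ * scaledMass V x R)
    {x : EuclideanSpace ℝ (Fin d)} (hpos : 0 < scaledMass V x 1) : 0 < criticalRadius V x := by
  refine lt_of_lt_of_le ?_ (le_criticalRadius hB hδ hdec hpos one_pos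
    (T := 1 + B * scaledMass V x 1) ?_ ?_)
  · positivity
  · have : 0 < B * scaledMass V x 1 := by positivity
    linarith
  · linarith

/-- The scaled mass is only almost monotone, so the bound `1` at some admissible radius beyond `r`
becomes `B` at `r`. -/
theorem scaledMass_le_of_lt_criticalRadius {d : ℕ} {V : EuclideanSpace ℝ (Fin d) → ℝ} {B δ : ℝ}
    (hB : 0 < B) (hδ : 0 < δ)
    (hdec : ∀ x r R, 0 < r → r ≤ R → scaledMass V x r ≤ B * (r / R) ^ δ * scaledMass V x R)
    {x : EuclideanSpace ℝ (Fin d)} {r : ℝ} (hr : 0 < r) (h : r < criticalRadius V x) :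
    scaledMass V x r ≤ B := by
  have hne : {r : ℝ | 0 < r ∧ scaledMass V x r ≤ 1}.Nonempty := by
    by_contra hne
    have h0 : criticalRadius V x = 0 := by
      have : criticalRadius V x = sSup {r : ℝ | 0 < r ∧ scaledMass V x r ≤ 1} := rfl
      rw [this, Set.not_nonempty_iff_eq_empty.1 hne, Real.sSup_empty]
    linarith
  obtain ⟨r', ⟨hr'0, hr'1⟩, hrr'⟩ := exists_lt_of_lt_csSup hne h
  calc scaledMass V x r ≤ B * (r / r') ^ δ * scaledMass V x r' := hdec x r r' hr hrr'.le
    _ ≤ B * (r / r') ^ δ * 1 := by gcongr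
    _ ≤ B * 1 * 1 := by
        gcongr
        exact Real.rpow_le_one (by positivity) ((div_le_one hr'0).2 hrr'.le) hδ.le
    _ = B := by ring

/-- Put `R = ρ(x)` and `u = 1 + |x - y| / R`. Since `B(y, u R) ⊆ B(x, 2 u R)`, growth from `B(x, R /
2)` bounds the scaled mass at `y` and radius `u R` by a multiple of `u ^ a`. Decay then makes the
radius `u R (E u ^ a) ^ (-1 / δ)` admissible at `y`; the spare factor `u ≥ 1` is discarded. -/
theorem exists_lower_comparison {d : ℕ} {V : EuclideanSpace ℝ (Fin d) → ℝ}
    (hV0 : ∀ x, 0 ≤ V x) (hV : LocallyIntegrable V) {D a B δ : ℝ}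
    (hD : 0 < D) (ha : 0 < a) (hB : 0 < B) (hδ : 0 < δ)
    (hgrow : ∀ x r R, 0 < r → r ≤ R →
      ∫ y in ball x R, V y ≤ D * (R / r) ^ a * ∫ y in ball x r, V y)
    (hdec : ∀ x r R, 0 < r → r ≤ R → scaledMass V x r ≤ B * (r / R) ^ δ * scaledMass V x R)
    (hpos : ∀ x, 0 < scaledMass V x 1) :
    ∃ C N : ℝ, 1 ≤ C ∧ 0 < N ∧ ∀ x y : EuclideanSpace ℝ (Fin d),
      C⁻¹ * (1 + ‖x - y‖ / criticalRadius V x) ^ (-N) ≤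
        criticalRadius V y / criticalRadius V x := by
  set E : ℝ := 1 + B * (D * 4 ^ a * B) with hE
  have h4a : 0 < (4 : ℝ) ^ a := by positivity
  have hE0 : 0 < B * (D * 4 ^ a * B) := by positivity
  have hE1 : 1 ≤ E := by linarith
  refine ⟨E ^ (1 / δ), a / δ, Real.one_le_rpow hE1 (by positivity), by positivity,
    fun x y => ?_⟩
  set R := criticalRadius V x with hR
  have hR0 : 0 < R := criticalRadius_pos hB hδ hdec (hpos x)
  set u := 1 + ‖x - y‖ / R with hu
  have hu1 : 1 ≤ u := le_add_of_nonneg_right (by positivity)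
  have hu0 : 0 < u := by linarith
  have hM : u * R = R + ‖x - y‖ := by rw [hu]; field_simp
  have hmass : scaledMass V y (u * R) ≤ D * 4 ^ a * B * u ^ a := by
    have h1 : ∫ z in ball y (u * R), V z ≤ ∫ z in ball x (2 * (u * R)), V z := by
      refine setIntegral_ball_mono hV0 (integrableOn_ball hV _ _) (ball_subset_ball' ?_)
      rw [dist_comm, dist_eq_norm, hM]
      linarith
    have h2 := hgrow x (R / 2) (2 * (u * R)) (by positivity) (by nlinarith)
    have h3 := scaledMass_le_of_lt_criticalRadius hB hδ hdec (half_pos hR0)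
      (show R / 2 < criticalRadius V x by rw [← hR]; linarith)
    have h4 : ∫ z in ball x (R / 2), V z ≤ B * (R / 2) ^ (d - 2) := by
      rw [scaledMass, one_div, inv_mul_le_iff₀ (by positivity)] at h3
      linarith
    have h5 : 2 * (u * R) / (R / 2) = 4 * u := by field_simp; norm_num
    rw [h5, Real.mul_rpow (by norm_num) hu0.le] at h2
    rw [scaledMass, one_div, inv_mul_le_iff₀ (by positivity)]
    calc _ ≤ D * (4 ^ a * u ^ a) * (B * (R / 2) ^ (d - 2)) := by
          refine (h1.trans h2).trans ?_
          gcongr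
      _ ≤ D * (4 ^ a * u ^ a) * (B * (u * R) ^ (d - 2)) := by
          gcongr
          nlinarith
      _ = _ := by ring
  have hua : 1 ≤ u ^ a := Real.one_le_rpow hu1 ha.le
  have key := le_criticalRadius hB hδ hdec (hpos y) (M := u * R) (T := E * u ^ a) (by positivity)
    (one_le_mul_of_one_le_of_one_le hE1 hua) (by
      calc B * scaledMass V y (u * R) ≤ B * (D * 4 ^ a * B * u ^ a) := by gcongr
        _ = (E - 1) * u ^ a := by rw [hE]; ring
        _ ≤ E * u ^ a := by gcongr; linarith)
  rw [le_div_iff₀ hR0]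
  refine le_trans ?_ key
  rw [Real.mul_rpow (by positivity) (by positivity), ← Real.rpow_mul hu0.le,
    Real.rpow_neg (by positivity : 0 ≤ E), show a * -(1 / δ) = -(a / δ) by ring]
  have : 0 < (E ^ (1 / δ))⁻¹ * u ^ (-(a / δ)) := by positivity
  nlinarith [mul_pos this hR0]

/-- The upper comparison of the critical radius at two points follows from the lower one. -/
theorem comparisonConstants_of_lower {d : ℕ} {ρ : EuclideanSpace ℝ (Fin d) → ℝ}
    (hρ : ∀ x, 0 < ρ x) {C N : ℝ} (hC : 1 ≤ C) (hN : 0 < N)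
    (h : ∀ x y, C⁻¹ * (1 + ‖x - y‖ / ρ x) ^ (-N) ≤ ρ y / ρ x) :
    ComparisonConstants ρ (C * 2 ^ N) N := by
  have h2N : (1 : ℝ) ≤ 2 ^ N := Real.one_le_rpow one_le_two hN.le
  have hC0 : 0 < C := by linarith
  have hCN : 1 ≤ C * 2 ^ N := one_le_mul_of_one_le_of_one_le hC h2N
  refine ⟨hCN, hN, fun x y => ⟨?_, ?_⟩⟩
  · refine le_trans ?_ (h x y)
    have := hρ x
    rw [one_div]
    gcongr
    exact le_mul_of_one_le_right hC0.le h2N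
  · have hx := hρ x
    have hy := hρ y
    set q := ρ y / ρ x with hq
    set u := 1 + ‖x - y‖ / ρ x with hu
    have hq0 : 0 < q := by positivity
    have hu1 : 1 ≤ u := le_add_of_nonneg_right (by positivity)
    have hu0 : 0 < u := by linarith
    have hN1 : 0 < N + 1 := by linarith
    have e1 : 1 + ‖y - x‖ / ρ y = 1 + (u - 1) / q := by
      rw [norm_sub_rev, hu, hq]; field_simp; ring
    have hw0 : 0 < 1 + (u - 1) / q := by
      have : 0 ≤ (u - 1) / q := div_nonneg (by linarith) hq0.le
      linarith
    -- The lower comparison with the two points exchanged, which bounds `q` implicitly.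
    have h1 : q ≤ C * (1 + (u - 1) / q) ^ N := by
      have h2 := h y x
      have hwN := Real.rpow_pos_of_pos hw0 N
      rw [e1, Real.rpow_neg hw0.le, ← mul_inv, ← inv_div (ρ y) (ρ x), ← hq,
        inv_le_inv₀ (by positivity) hq0] at h2
      exact h2
    -- If `q ≤ u`, the base is at most `2 u / q` and the inequality can be solved for `q ^ (N + 1)`,
    -- which produces the exponent `N / (N + 1)`; otherwise the base is at most `2`.
    rcases le_total q u with hqu | hqu
    · have h2 : 1 + (u - 1) / q ≤ 2 * u / q := by
        rw [le_div_iff₀ hq0, add_mul, div_mul_cancel₀ _ hq0.ne']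
        linarith
      have h3 : q ^ (N + 1) ≤ C * 2 ^ N * u ^ N := by
        have h4 : q ≤ C * (2 * u / q) ^ N := h1.trans (by gcongr)
        rw [Real.div_rpow (by positivity) hq0.le, ← mul_div_assoc,
          le_div_iff₀ (by positivity), Real.mul_rpow two_pos.le hu0.le] at h4
        rw [Real.rpow_add_one hq0.ne']
        linarith
      calc q = (q ^ (N + 1)) ^ (1 / (N + 1)) := by
            rw [← Real.rpow_mul hq0.le, mul_one_div_cancel hN1.ne', Real.rpow_one]
        _ ≤ (C * 2 ^ N * u ^ N) ^ (1 / (N + 1)) := by gcongr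
        _ = (C * 2 ^ N) ^ (1 / (N + 1)) * u ^ (N / (N + 1)) := by
            rw [Real.mul_rpow (by positivity) (by positivity), ← Real.rpow_mul hu0.le,
              mul_one_div]
        _ ≤ _ := by
            gcongr
            refine Real.rpow_le_self_of_one_le hCN ?_
            rw [div_le_one hN1]
            linarith
    · have h2 : 1 + (u - 1) / q ≤ 2 := by
        have : (u - 1) / q ≤ 1 := (div_le_one hq0).2 (by linarith)
        linarith
      calc q ≤ C * 2 ^ N := h1.trans (by gcongr)
        _ ≤ _ := le_mul_of_one_le_right (by positivity) (Real.one_le_rpow hu1 (by positivity))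

end SchrodingerBLO

end

theorem mainTheorem10 (d : ℕ) (hd : 3 ≤ d) (V : EuclideanSpace ℝ (Fin d) → ℝ) (s : ℝ≥0∞)
    (hs : (d : ℝ≥0∞) / 2 ≤ s)
    (hV_nonneg : ∀ x, 0 ≤ V x)
    (hV_loc : LocallyIntegrable V volume)
    (hV_ne : ¬ (∀ᵐ x ∂(volume : Measure (EuclideanSpace ℝ (Fin d))), V x = 0))
    (hV_RH : SchrodingerBLO.ReverseHolder s V) :
    (∃ C₀ N₀ : ℝ,
      SchrodingerBLO.ComparisonConstants (SchrodingerBLO.criticalRadius V) C₀ N₀) ∧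
    ∀ C₀ N₀ : ℝ,
      SchrodingerBLO.ComparisonConstants (SchrodingerBLO.criticalRadius V) C₀ N₀ →
      ∀ θ : ℝ, 0 < θ →
        ∃ C γ : ℝ, 0 < C ∧ 0 < γ ∧
          ∀ f : EuclideanSpace ℝ (Fin d) → ℝ,
            SchrodingerBLO.MemBLO (SchrodingerBLO.criticalRadius V) θ f →
            ∀ (x₀ : EuclideanSpace ℝ (Fin d)) (r : ℝ), 0 < r →
              IntegrableOn
                (fun x => Real.exp
                  ((1 + r / SchrodingerBLO.criticalRadius V x₀) ^ (-((N₀ + 1) * θ)) *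
                    (γ / SchrodingerBLO.bloNorm (SchrodingerBLO.criticalRadius V) θ f) *
                    (f x - SchrodingerBLO.essInfOn f (SchrodingerBLO.cube x₀ r))))
                (SchrodingerBLO.cube x₀ r) volume ∧
              ∫ x in SchrodingerBLO.cube x₀ r,
                  Real.exp
                    ((1 + r / SchrodingerBLO.criticalRadius V x₀) ^ (-((N₀ + 1) * θ)) *
                      (γ / SchrodingerBLO.bloNorm (SchrodingerBLO.criticalRadius V) θ f) *
                      (f x - SchrodingerBLO.essInfOn f (SchrodingerBLO.cube x₀ r)))
                ≤ C * volume.real (SchrodingerBLO.cube x₀ r) := by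
  have hp : ENNReal.ofReal ((d : ℝ) / 2) ≤ s := by
    rw [ENNReal.ofReal_div_of_pos two_pos, ENNReal.ofReal_natCast, ENNReal.ofReal_ofNat]
    exact hs
  obtain ⟨D, a, B, δ, hD, ha, hB, hδ, hgrow, hdec⟩ :=
    SchrodingerBLO.exists_growth_of_reverseHolder hd hV_nonneg hV_loc (hV_RH.mono hV_loc hp)
  have hpos : ∀ x, 0 < SchrodingerBLO.scaledMass V x 1 := fun x => by
    have := SchrodingerBLO.setIntegral_ball_pos hV_nonneg hV_loc hV_ne hgrow x one_pos
    rw [SchrodingerBLO.scaledMass]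
    positivity
  have hρ : ∀ x, 0 < SchrodingerBLO.criticalRadius V x := fun x =>
    SchrodingerBLO.criticalRadius_pos hB hδ hdec (hpos x)
  refine ⟨?_, fun C₀ N₀ h θ hθ => SchrodingerBLO.exists_integral_exp_le (by omega) hρ h hθ⟩
  obtain ⟨C, N, hC, hN, h⟩ := SchrodingerBLO.exists_lower_comparison hV_nonneg hV_loc
    (by linarith) ha hB hδ hgrow hdec hpos
  exact ⟨_, _, SchrodingerBLO.comparisonConstants_of_lower hρ hC hN h⟩
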